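/- **Theorem 5.5.** Let $\mu,\lambda$ be finite, positive (regular) Borel measures on the unit circle $\partial\mathbb D$. For such a measure $\mu$ let $H^2(\mu)$ be the closure of the analytic polynomials in $L^2(\mu)$, let $Z^\mu$ be multiplication by $\zeta$ on $H^2(\mu)$, let $(\mathscr C_\mu h)(z)=\int_{\partial\mathbb D}\frac{h(\zeta)}{1-z\overline\zeta}\,\mu(d\zeta)$, $z\in\mathbb D$, be the Cauchy transform of $h\in H^2(\mu)$, and let $\mathscr H^+(\mu)=\mathscr C_\mu H^2(\mu)$, a Hilbert space of functions on $\mathbb D$ with the inner product $\langle \mathscr C_\mu g,\mathscr C_\mu h\rangle_\mu=\langle g,h\rangle_{L^2(\mu)}$ (the map $\mathscr C_\mu$ is injective on $H^2(\mu)$). Put $V_\mu=\mathscr C_\mu Z^\mu\mathscr C_\mu^*$ and $\mathrm{int}(\mu,\lambda)=\mathscr H^+(\mu)\cap\mathscr H^+(\lambda)$. A linear subspace of $\mathscr H^+(\mu)$, closed or not, is called $V_\mu$-reducing if it is invariant under $V_\mu$ and $V_\mu^*$. We say that $\mu$ is RK-absolutely continuous with respect to $\lambda$ if $\mathrm{int}(\mu,\lambda)$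 is norm-dense in $\mathscr H^+(\mu)$, and RK-singular with respect to $\lambda$ if $\mathrm{int}(\mu,\lambda)=\{0\}$. The measure $\lambda$ is extreme if $b_\lambda=\frac{H_\lambda-1}{H_\lambda+1}$, where $H_\lambda(z)=\int_{\partial\mathbb D}\frac{1+z\overline\zeta}{1-z\overline\zeta}\,\lambda(d\zeta)$, is an extreme point of the convex set of analytic functions on $\mathbb D$ bounded by $1$ in modulus, and non-extreme otherwise. (a) If $\lambda$ is non-extreme, then $\mathrm{int}(\mu,\lambda)$ is $V_\mu$-reducing. (b) Suppose that $\mathrm{int}(\mu,\lambda)$ is $V_\mu$-reducing, and let $\mu=\mu_{ac}+\mu_s$ be the Lebesgue decomposition of $\mu$ with respect to $\lambda$. Then $\mathscr H^+(\mu_{ac})$ and $\mathscr H^+(\mu_s)$ are isometrically contained in $\mathscr H^+(\mu)$, and $\mathscr H^+(\mu)$ is their orthogonal direct sum, $$\mathscr H^+(\mu)=\mathscr H^+(\mu_{ac})\oplus\mathscr H^+(\mu_s).$$ Moreover $\mathscr H^+(\mu_{ac})$ is the closure of $\mathrm{int}(\mu,\lambda)$ in the norm of $\mathscr H^+(\mu)$,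 and $\mathscr H^+(\mu_s)\cap\mathscr H^+(\lambda)=\{0\}$. That is, $\mu_{ac}$ is the largest positive measure $\gamma\le\mu$ which is RK-absolutely continuous with respect to $\lambda$, and $\mu_s$ is RK-singular with respect to $\lambda$. -/

import Mathlib

open MeasureTheory Polynomial
open scoped ComplexConjugate ENNReal InnerProductSpace Complex.UnitDisc

noncomputable section

/-- The unit circle carries its Borel `σ`-algebra. -/
instance Circle.instMeasurableSpaceBorel : MeasurableSpace Circle := borel Circle

instance Circle.instBorelSpaceBorel : BorelSpace Circle := ⟨rfl⟩

namespace CauchyTransform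

theorem continuous_circle_coe : Continuous (fun ζ : Circle => (ζ : ℂ)) := continuous_subtype_val

/-! ### The Hardy space `H²(μ)` -/

/-- The independent variable `ζ` as a continuous function on the circle. -/
def zeta : C(Circle, ℂ) := ⟨fun ζ => (ζ : ℂ), continuous_circle_coe⟩

theorem zeta_apply (ζ : Circle) : zeta ζ = (ζ : ℂ) := rfl

/-- An analytic polynomial, as an element of `L²(μ)`. -/
def polyLp (μ : Measure Circle) [IsFiniteMeasure μ] : ℂ[X] →ₗ[ℂ] Lp ℂ 2 μ :=
  (ContinuousMap.toLp 2 μ ℂ).toLinearMap ∘ₗ (Polynomial.aeval zeta).toLinearMap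

/-- `H²(μ)`: the closure of the analytic polynomials in `L²(μ)`. -/
def H2 (μ : Measure Circle) [IsFiniteMeasure μ] : Submodule ℂ (Lp ℂ 2 μ) :=
  (LinearMap.range (polyLp μ)).topologicalClosure

instance instCompleteSpaceH2 (μ : Measure Circle) [IsFiniteMeasure μ] : CompleteSpace (H2 μ) :=
  (Submodule.isClosed_topologicalClosure _).completeSpace_coe

theorem memLp_zeta_mul {μ : Measure Circle} (h : Lp ℂ 2 μ) :
    MemLp (fun ζ : Circle => (ζ : ℂ) * h ζ) 2 μ := by
  have h1 : AEStronglyMeasurable (fun ζ : Circle => (ζ : ℂ)) μ :=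
    continuous_circle_coe.aestronglyMeasurable
  refine (Lp.memLp h).of_le (h1.mul (Lp.aestronglyMeasurable h)) ?_
  exact Filter.Eventually.of_forall fun ζ => by simp [Circle.norm_coe]

/-- Multiplication by the independent variable, `(M_ζ h)(ζ) = ζ h(ζ)`, on `L²(μ)`. -/
def mulZeta (μ : Measure Circle) : Lp ℂ 2 μ →ₗᵢ[ℂ] Lp ℂ 2 μ where
  toFun h := (memLp_zeta_mul h).toLp _
  map_add' f g := by
    rw [← MemLp.toLp_add]
    refine MemLp.toLp_congr _ _ ?_
    filter_upwards [Lp.coeFn_add f g] with ζ hζ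
    rw [hζ, Pi.add_apply, Pi.add_apply, mul_add]
  map_smul' c f := by
    rw [RingHom.id_apply, ← MemLp.toLp_const_smul]
    refine MemLp.toLp_congr _ _ ?_
    filter_upwards [Lp.coeFn_smul c f] with ζ hζ
    simp only [hζ, Pi.smul_apply, smul_eq_mul]
    ring
  norm_map' f := by
    change ‖(memLp_zeta_mul f).toLp _‖ = ‖f‖
    rw [Lp.norm_toLp, Lp.norm_def]
    congr 1
    exact eLpNorm_congr_norm_ae (Filter.Eventually.of_forall fun ζ => by simp [Circle.norm_coe])

theorem mulZeta_polyLp (μ : Measure Circle) [IsFiniteMeasure μ] (p : ℂ[X]) :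
    mulZeta μ (polyLp μ p) = polyLp μ (X * p) := by
  apply Lp.ext
  have h1 : mulZeta μ (polyLp μ p) =ᵐ[μ] fun ζ : Circle => (ζ : ℂ) * polyLp μ p ζ :=
    MemLp.coeFn_toLp (memLp_zeta_mul (polyLp μ p))
  have h2 : polyLp μ p =ᵐ[μ] Polynomial.aeval zeta p :=
    ContinuousMap.coeFn_toLp (𝕜 := ℂ) μ _
  have h3 : polyLp μ (X * p) =ᵐ[μ] Polynomial.aeval zeta (X * p) :=
    ContinuousMap.coeFn_toLp (𝕜 := ℂ) μ _
  filter_upwards [h1, h2, h3] with ζ e1 e2 e3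
  rw [e1, e2, e3]
  simp [zeta_apply]

theorem mulZeta_mem_H2 (μ : Measure Circle) [IsFiniteMeasure μ] {h : Lp ℂ 2 μ} (hh : h ∈ H2 μ) :
    mulZeta μ h ∈ H2 μ := by
  refine map_mem_closure (mulZeta μ).continuous hh ?_
  rintro _ ⟨p, rfl⟩
  exact ⟨X * p, (mulZeta_polyLp μ p).symm⟩

/-- `Z^μ`: the restriction of `M_ζ` to `H²(μ)`. -/
def Z (μ : Measure Circle) [IsFiniteMeasure μ] : H2 μ →L[ℂ] H2 μ :=
  ((mulZeta μ).toContinuousLinearMap ∘L (H2 μ).subtypeL).codRestrict (H2 μ)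
    fun h => mulZeta_mem_H2 μ h.2

/-! ### Cauchy transforms -/

theorem one_sub_conj_mul_ne_zero (z : 𝔻) (ζ : Circle) : 1 - conj (z : ℂ) * (ζ : ℂ) ≠ 0 := by
  intro h
  have h1 : ‖conj (z : ℂ) * (ζ : ℂ)‖ = 1 := by rw [← sub_eq_zero.mp h, norm_one]
  rw [norm_mul, RCLike.norm_conj, Circle.norm_coe, mul_one] at h1
  exact z.norm_ne_one h1

/-- The Szegő kernel vector `k_z(ζ) = (1 - z̄ ζ)⁻¹`. -/
def szego (z : 𝔻) : C(Circle, ℂ) :=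
  ⟨fun ζ => (1 - conj (z : ℂ) * (ζ : ℂ))⁻¹,
    (continuous_const.sub (continuous_const.mul continuous_circle_coe)).inv₀
      (one_sub_conj_mul_ne_zero z)⟩

theorem szego_apply (z : 𝔻) (ζ : Circle) : szego z ζ = (1 - conj (z : ℂ) * (ζ : ℂ))⁻¹ := rfl

/-- `(𝒞_μ h)(z) = ∫ h(ζ) / (1 - z ζ̄) μ(dζ)`. -/
def cauchyFun (μ : Measure Circle) (h : Circle → ℂ) (z : 𝔻) : ℂ :=
  ∫ ζ : Circle, h ζ / (1 - (z : ℂ) * conj (ζ : ℂ)) ∂μ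

theorem cauchyFun_eq_inner (μ : Measure Circle) [IsFiniteMeasure μ] (h : Lp ℂ 2 μ) (z : 𝔻) :
    cauchyFun μ h z = ⟪ContinuousMap.toLp 2 μ ℂ (szego z), h⟫_ℂ := by
  rw [L2.inner_def]
  refine integral_congr_ae ?_
  filter_upwards [ContinuousMap.coeFn_toLp (p := 2) (𝕜 := ℂ) μ (szego z)] with ζ hζ
  rw [hζ]
  simp [szego_apply, div_eq_mul_inv]

/-- The `μ`-Cauchy transform on `H²(μ)`. -/
def cauchy (μ : Measure Circle) [IsFiniteMeasure μ] : H2 μ →ₗ[ℂ] (𝔻 → ℂ) where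
  toFun h := cauchyFun μ (h : Lp ℂ 2 μ)
  map_add' f g := by
    ext z
    simp only [Pi.add_apply, cauchyFun_eq_inner, Submodule.coe_add, inner_add_right]
  map_smul' c f := by
    ext z
    simp only [Pi.smul_apply, cauchyFun_eq_inner, Submodule.coe_smul, inner_smul_right,
      RingHom.id_apply, smul_eq_mul]

theorem hasSum_szego (z : 𝔻) :
    HasSum (fun n : ℕ => conj (z : ℂ) ^ n • zeta ^ n) (szego z) := by
  have hz : ‖conj (z : ℂ)‖ < 1 := by rw [RCLike.norm_conj]; exact z.norm_lt_one
  have hs : Summable (fun n : ℕ => conj (z : ℂ) ^ n • zeta ^ n) := by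
    refine Summable.of_norm_bounded (summable_geometric_of_lt_one (norm_nonneg _) hz) fun n => ?_
    refine (ContinuousMap.norm_le _ (by positivity)).2 fun ζ => ?_
    simp [zeta_apply, Circle.norm_coe]
  refine hs.hasSum_iff.2 ?_
  ext ζ
  refine (ContinuousMap.tsum_apply hs ζ).symm.trans ?_
  have h1 : ‖conj (z : ℂ) * (ζ : ℂ)‖ < 1 := by simpa [Circle.norm_coe] using z.norm_lt_one
  simpa [szego_apply, zeta_apply, mul_pow] using tsum_geometric_of_norm_lt_one h1

theorem cauchy_injective (μ : Measure Circle) [IsFiniteMeasure μ] :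
    Function.Injective (cauchy μ) := by
  rw [injective_iff_map_eq_zero]
  intro h hh
  set a : ℕ → ℂ := fun n => ⟪polyLp μ (X ^ n), (h : Lp ℂ 2 μ)⟫_ℂ with ha
  have hsum : ∀ z : 𝔻, HasSum (fun n => (z : ℂ) ^ n * a n) 0 := by
    intro z
    have h0 : ⟪ContinuousMap.toLp 2 μ ℂ (szego z), (h : Lp ℂ 2 μ)⟫_ℂ = 0 := by
      rw [← cauchyFun_eq_inner]
      exact congrFun hh z
    have h1 := (hasSum_szego z).mapL (ContinuousMap.toLp 2 μ ℂ)
    have h2 := h1.mapL (innerSL ℂ (h : Lp ℂ 2 μ))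
    have h3 := h2.star
    simp only [innerSL_apply_apply, map_smul, smul_eq_mul] at h3
    have h4 : star ⟪(h : Lp ℂ 2 μ), ContinuousMap.toLp 2 μ ℂ (szego z)⟫_ℂ = 0 := by
      rw [← h0]; exact inner_conj_symm _ _
    rw [h4] at h3
    have h5 : (fun n => star (conj (z : ℂ) ^ n *
        ⟪(h : Lp ℂ 2 μ), ContinuousMap.toLp 2 μ ℂ (zeta ^ n)⟫_ℂ)) =
        fun n => (z : ℂ) ^ n * a n := by
      funext n
      have h6 : star ⟪(h : Lp ℂ 2 μ), ContinuousMap.toLp 2 μ ℂ (zeta ^ n)⟫_ℂ = a n := by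
        change conj _ = _
        rw [inner_conj_symm]
        simp [ha, polyLp]
      rw [star_mul', h6]
      simp
    rw [h5] at h3
    exact h3
  have hp : HasFPowerSeriesAt (0 : ℂ → ℂ) (FormalMultilinearSeries.ofScalars ℂ a) 0 := by
    rw [hasFPowerSeriesAt_iff]
    filter_upwards [Metric.ball_mem_nhds (0 : ℂ) one_pos] with z hz
    have := hsum ⟨z, hz⟩
    simp only [FormalMultilinearSeries.coeff_ofScalars, smul_eq_mul, Pi.zero_apply]
    exact this
  have ha0 : ∀ n, a n = 0 := by
    intro n
    have := congrArg (fun p => FormalMultilinearSeries.coeff p n) hp.eq_zero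
    simp only [FormalMultilinearSeries.coeff_ofScalars] at this
    rw [this]
    rfl
  have horth : ∀ p : ℂ[X], ⟪polyLp μ p, (h : Lp ℂ 2 μ)⟫_ℂ = 0 := by
    intro p
    induction p using Polynomial.induction_on' with
    | add p q hp hq => rw [map_add, inner_add_left, hp, hq, add_zero]
    | monomial n c =>
      rw [← Polynomial.smul_X_eq_monomial, map_smul, inner_smul_left]
      have := ha0 n
      simp only [ha] at this
      rw [this, mul_zero]
  have hmem : (h : Lp ℂ 2 μ) ∈ (LinearMap.range (polyLp μ))ᗮ := by
    rw [Submodule.mem_orthogonal]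
    rintro _ ⟨p, rfl⟩
    exact horth p
  rw [← Submodule.orthogonal_closure] at hmem
  have h5 : ⟪(h : Lp ℂ 2 μ), (h : Lp ℂ 2 μ)⟫_ℂ = 0 :=
    (Submodule.mem_orthogonal _ _).1 hmem _ h.2
  exact Subtype.ext (inner_self_eq_zero.1 h5)

/-! ### The space of `μ`-Cauchy transforms -/

/-- `ℋ⁺(μ) = 𝒞_μ H²(μ)`, a vector space of functions on the disk. It is a type of its own, rather
than a subspace, because its norm (below) does not induce the topology of pointwise convergence. -/
def HPlus (μ : Measure Circle) [IsFiniteMeasure μ] : Type := LinearMap.range (cauchy μ)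

section HPlus

variable (μ : Measure Circle) [IsFiniteMeasure μ]

instance : AddCommGroup (HPlus μ) := inferInstanceAs (AddCommGroup (LinearMap.range (cauchy μ)))

instance : Module ℂ (HPlus μ) := inferInstanceAs (Module ℂ (LinearMap.range (cauchy μ)))

/-- The inclusion of `ℋ⁺(μ)` into all functions on the disk. -/
def HPlus.toFunₗ : HPlus μ →ₗ[ℂ] (𝔻 → ℂ) := (LinearMap.range (cauchy μ)).subtype

/-- The Cauchy transform as a linear bijection of `H²(μ)` onto `ℋ⁺(μ)`. -/
def cauchyEquiv : H2 μ ≃ₗ[ℂ] HPlus μ := LinearEquiv.ofInjective (cauchy μ) (cauchy_injective μ)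

/-- The norm of `ℋ⁺(μ)`: `‖𝒞_μ g‖ = ‖g‖` in `L²(μ)`. -/
instance : NormedAddCommGroup (HPlus μ) :=
  NormedAddCommGroup.induced (HPlus μ) (H2 μ) (cauchyEquiv μ).symm (cauchyEquiv μ).symm.injective

/-- The inner product of `ℋ⁺(μ)`: `⟪𝒞_μ g, 𝒞_μ h⟫ = ⟪g, h⟫` in `L²(μ)`. -/
instance : InnerProductSpace ℂ (HPlus μ) := InnerProductSpace.induced (cauchyEquiv μ).symm

/-- The Cauchy transform `𝒞_μ` as a unitary of `H²(μ)` onto `ℋ⁺(μ)`. -/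
def cauchyU : H2 μ ≃ₗᵢ[ℂ] HPlus μ :=
  { cauchyEquiv μ with
    norm_map' := fun h => by
      change ‖(cauchyEquiv μ).symm (cauchyEquiv μ h)‖ = ‖h‖
      rw [LinearEquiv.symm_apply_apply] }

instance : CompleteSpace (HPlus μ) :=
  ((cauchyU μ).toIsometryEquiv.completeSpace_iff).1 inferInstance

/-- `ℋ⁺(μ)` is a reproducing kernel Hilbert space of functions on the disk. -/
instance : RKHS ℂ (HPlus μ) 𝔻 ℂ where
  coeCLM :=
    { HPlus.toFunₗ μ with
      cont := by
        refine continuous_pi fun z => ?_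
        have : (fun f : HPlus μ => HPlus.toFunₗ μ f z) = fun f : HPlus μ =>
            ⟪ContinuousMap.toLp 2 μ ℂ (szego z), (((cauchyU μ).symm f : H2 μ) : Lp ℂ 2 μ)⟫_ℂ := by
          funext f
          obtain ⟨g, rfl⟩ := (cauchyU μ).surjective f
          rw [LinearIsometryEquiv.symm_apply_apply, ← cauchyFun_eq_inner]
          rfl
        change Continuous (fun f : HPlus μ => HPlus.toFunₗ μ f z)
        rw [this]
        exact (innerSL ℂ _).continuous.comp
          (continuous_subtype_val.comp (cauchyU μ).symm.continuous) }
  coeCLM_injective := Subtype.val_injective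

theorem cauchyU_apply (h : H2 μ) (z : 𝔻) : cauchyU μ h z = cauchyFun μ (h : Lp ℂ 2 μ) z := rfl

theorem inner_cauchyU (g h : H2 μ) : ⟪cauchyU μ g, cauchyU μ h⟫_ℂ = ⟪(g : Lp ℂ 2 μ), h⟫_ℂ :=
  (cauchyU μ).inner_map_map g h

/-- `V_μ = 𝒞_μ Z^μ 𝒞_μ^*`. -/
def V : HPlus μ →L[ℂ] HPlus μ :=
  (cauchyU μ).toContinuousLinearEquiv.toContinuousLinearMap ∘L Z μ ∘L
    (cauchyU μ).symm.toContinuousLinearEquiv.toContinuousLinearMap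

end HPlus

/-! ### The intersection space -/

/-- `int(μ, λ) = ℋ⁺(μ) ∩ ℋ⁺(λ)`, an intersection of spaces of functions on the disk, regarded as a
(not necessarily closed) linear subspace of `ℋ⁺(μ)`. -/
def intSpace (μ lam : Measure Circle) [IsFiniteMeasure μ] [IsFiniteMeasure lam] :
    Submodule ℂ (HPlus μ) :=
  (LinearMap.range (HPlus.toFunₗ lam)).comap (HPlus.toFunₗ μ)

theorem mem_intSpace {μ lam : Measure Circle} [IsFiniteMeasure μ] [IsFiniteMeasure lam]
    {h : HPlus μ} : h ∈ intSpace μ lam ↔ ∃ k : HPlus lam, (k : 𝔻 → ℂ) = h := Iff.rfl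

/-- A linear subspace, closed or not, reduces `T` if it is invariant for `T` and for `T^*`. -/
def IsReducing {H : Type*} [NormedAddCommGroup H] [InnerProductSpace ℂ H] [CompleteSpace H]
    (T : H →L[ℂ] H) (M : Submodule ℂ H) : Prop :=
  ∀ h ∈ M, T h ∈ M ∧ ContinuousLinearMap.adjoint T h ∈ M

/-- `μ ≪_RK λ`: `int(μ, λ)` is norm-dense in `ℋ⁺(μ)`. -/
def RKAbsolutelyContinuous (μ lam : Measure Circle) [IsFiniteMeasure μ] [IsFiniteMeasure lam] :
    Prop :=
  Dense (intSpace μ lam : Set (HPlus μ))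

/-- `μ ⟂_RK λ`: `int(μ, λ) = {0}`. -/
def RKSingular (μ lam : Measure Circle) [IsFiniteMeasure μ] [IsFiniteMeasure lam] : Prop :=
  intSpace μ lam = ⊥

/-- The isometry `e` is the inclusion map: it sends a function in `ℋ⁺(ν)` to the same function,
regarded as an element of `ℋ⁺(μ)`. -/
def IsInclusion {μ ν : Measure Circle} [IsFiniteMeasure μ] [IsFiniteMeasure ν]
    (e : HPlus ν →ₗᵢ[ℂ] HPlus μ) : Prop :=
  ∀ h : HPlus ν, (e h : 𝔻 → ℂ) = h

/-! ### Extreme measures -/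

/-- The contractive analytic functions in the disk (the closed unit ball of `H^∞`). -/
def contractiveAnalytic : Set (𝔻 → ℂ) :=
  {b | (∃ F : ℂ → ℂ, DifferentiableOn ℂ F (Metric.ball 0 1) ∧ ∀ z : 𝔻, b z = F z) ∧
    ∀ z, ‖b z‖ ≤ 1}

/-- The Herglotz–Riesz transform `H_μ(z) = ∫ (1 + z ζ̄) / (1 - z ζ̄) μ(dζ)`. -/
def herglotz (μ : Measure Circle) (z : 𝔻) : ℂ :=
  ∫ ζ : Circle, (1 + (z : ℂ) * conj (ζ : ℂ)) / (1 - (z : ℂ) * conj (ζ : ℂ)) ∂μ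

/-- The contractive analytic function `b_μ = (H_μ - 1) / (H_μ + 1)` whose Clark measure is `μ`. -/
def clark (μ : Measure Circle) (z : 𝔻) : ℂ := (herglotz μ z - 1) / (herglotz μ z + 1)

/-- `μ` is extreme if `b_μ` is an extreme point of the convex set of contractive analytic functions
in the disk. -/
def IsExtremeMeasure (μ : Measure Circle) : Prop :=
  clark μ ∈ Set.extremePoints ℝ contractiveAnalytic

end CauchyTransform

end

open CauchyTransform

/-! The Taylor coefficients of `𝒞_μ h` are the Fourier coefficients of the measure `hμ` of index `n
≥ 0` (`cauchyFun_eq_iff`). So `𝒞_μ g` lies in `int(μ, λ)` exactly when some `k ∈ L²(λ)` makes all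
coefficients of `gμ - kλ` of index `n ≥ 0` vanish. Projecting an `L²(μ)` function onto `H²(μ)` does
not affect these coefficients.

(a) `V_μ^*` is the backward shift, and replacing `k` by `ζ̄k` gives its invariance for any `λ`. For
`V_μ`, the pair `ζg`, `ζk` can fail to match only at index `0`, and a multiple of a constant in
`ℋ⁺(λ)` repairs this (`isReducing_of_containsConst`). If `λ` is non-extreme, a proper convex
combination equal to `b_λ` yields a non-zero analytic `G` with `|G|² ≤ Re H_λ`. Write `G = z^k F`
with `F(0) ≠ 0`. Integrating against `|q|²` on circles of radius `r < 1` and letting `r → 1` gives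
`|q(0)F(0)|² ≤ ∫|q|² dλ` for polynomials `q` (`norm_eval_zero_le`). So `1` has positive distance
from `ζ·ℂ[ζ]` in `L²(λ)`, and the part of `1` orthogonal to that space has a constant, non-zero
Cauchy transform.

(b) There are two cases. If `ℋ⁺(λ)` contains the constants, then some `|g|²λ` is a non-zero multiple
of Lebesgue measure, and an F. and M. Riesz theorem makes `gμ - kλ` vanish on `λ`-null sets
(`ae_eq_zero_on_null_of_coef`). If it does not, then invariance under `V_μ` forces the coefficients
of negative index to match too, so `gμ = kλ` (`coef_eq_of_isReducing`). In both cases `g` vanishes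
on `λ`-null sets.

The same dichotomy shows that a set `E` which carries `λ`, with `μ|E ≪ λ`, splits `H²(μ)`: its
indicator preserves `L²(μ) ⊖ H²(μ)` (`splits_of_isReducing`). The orthogonal decomposition follows.
Density of `int(μ_ac, λ)` comes from truncating the density of `μ_ac`. Maximality of `μ_ac` comes
from testing the functional `h ↦ ∫_{Eᶜ} h dγ` on the constant `1`. -/

noncomputable section

namespace CauchyTransform

/-! ### Trigonometric polynomials -/

/-- The character `ζ ↦ ζ ^ n` of the circle. -/
def zetaPow (n : ℤ) : C(Circle, ℂ) :=
  ⟨fun ζ => ((ζ ^ n : Circle) : ℂ), continuous_circle_coe.comp (continuous_zpow n)⟩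

theorem zetaPow_apply (n : ℤ) (ζ : Circle) : zetaPow n ζ = ((ζ ^ n : Circle) : ℂ) := rfl

theorem zetaPow_natCast (n : ℕ) : zetaPow n = zeta ^ n := by
  ext ζ
  simp [zetaPow_apply, zeta_apply]

theorem star_zetaPow (n : ℤ) : star (zetaPow n) = zetaPow (-n) := by
  ext ζ
  simp only [ContinuousMap.star_apply, zetaPow_apply, zpow_neg, Circle.coe_inv_eq_conj]
  rfl

/-- Trigonometric polynomials, as a star subalgebra of the continuous functions. -/
def trigPoly : StarSubalgebra ℂ C(Circle, ℂ) where
  toSubalgebra := Algebra.adjoin ℂ (Set.range zetaPow)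
  star_mem' := by
    change Algebra.adjoin ℂ (Set.range zetaPow) ≤ star (Algebra.adjoin ℂ (Set.range zetaPow))
    refine Algebra.adjoin_le ?_
    rintro _ ⟨n, rfl⟩
    exact Algebra.subset_adjoin ⟨-n, (star_zetaPow n).symm⟩

/-- The characters form a multiplicative monoid, so the algebra they generate is just their linear
span. -/
theorem trigPoly_coe :
    Subalgebra.toSubmodule trigPoly.toSubalgebra = Submodule.span ℂ (Set.range zetaPow) := by
  apply Algebra.adjoin_eq_span_of_subset
  refine Set.Subset.trans ?_ Submodule.subset_span
  intro x hx
  refine Submonoid.closure_induction (fun _ => id) ⟨0, ?_⟩ ?_ hx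
  · ext ζ
    simp [zetaPow_apply]
  · rintro _ _ - - ⟨m, rfl⟩ ⟨n, rfl⟩
    refine ⟨m + n, ?_⟩
    ext ζ
    simp [zetaPow_apply, zpow_add]

theorem trigPoly_topologicalClosure : trigPoly.topologicalClosure = ⊤ := by
  refine ContinuousMap.starSubalgebra_topologicalClosure_eq_top_of_separatesPoints trigPoly ?_
  intro x y hxy
  refine ⟨_, ⟨zetaPow 1, Algebra.subset_adjoin ⟨1, rfl⟩, rfl⟩, ?_⟩
  have : (x : ℂ) ≠ y := fun e => hxy (Circle.ext e)
  simpa [zetaPow_apply] using this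

theorem dense_span_zetaPow :
    (Submodule.span ℂ (Set.range zetaPow)).topologicalClosure = ⊤ := by
  rw [← trigPoly_coe]
  exact congrArg (Subalgebra.toSubmodule <| StarSubalgebra.toSubalgebra ·)
    trigPoly_topologicalClosure

/-- A continuous linear map on `C(𝕋)` is determined by its values on the characters. -/
theorem clm_ext_zetaPow {F : Type*} [NormedAddCommGroup F] [NormedSpace ℂ F]
    {S T : C(Circle, ℂ) →L[ℂ] F} (h : ∀ n, S (zetaPow n) = T (zetaPow n)) : S = T := by
  refine ContinuousLinearMap.ext_on (s := Set.range zetaPow) ?_ ?_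
  · exact Submodule.dense_iff_topologicalClosure_eq_top.2 dense_span_zetaPow
  · rintro _ ⟨n, rfl⟩
    exact h n

/-! ### Fourier coefficients -/

/-- The Fourier coefficients `∫ ζ⁻ⁿ h(ζ) μ(dζ)` of the measure `h μ`. -/
def coef (μ : Measure Circle) (h : Circle → ℂ) (n : ℤ) : ℂ :=
  ∫ ζ : Circle, zetaPow (-n) ζ * h ζ ∂μ

theorem norm_zetaPow (n : ℤ) (ζ : Circle) : ‖zetaPow n ζ‖ = 1 := Circle.norm_coe _

theorem conj_zetaPow (n : ℤ) (ζ : Circle) : conj (zetaPow n ζ) = zetaPow (-n) ζ := by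
  rw [← star_zetaPow]
  rfl

theorem zetaPow_mul (m n : ℤ) (ζ : Circle) : zetaPow m ζ * zetaPow n ζ = zetaPow (m + n) ζ := by
  simp [zetaPow_apply, zpow_add]

theorem zetaPow_zero (ζ : Circle) : zetaPow 0 ζ = 1 := by simp [zetaPow_apply]

theorem zetaPow_one (ζ : Circle) : zetaPow 1 ζ = ζ := by simp [zetaPow_apply]

theorem memLp_zetaPow_mul {μ : Measure Circle} {h : Circle → ℂ} {p : ℝ≥0∞} (hh : MemLp h p μ)
    (n : ℤ) : MemLp (fun ζ => zetaPow n ζ * h ζ) p μ :=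
  hh.of_le ((zetaPow n).continuous.aestronglyMeasurable.mul hh.1)
    (Filter.Eventually.of_forall fun ζ => by rw [norm_mul, norm_zetaPow, one_mul])

theorem integrable_zetaPow_mul {μ : Measure Circle} {h : Circle → ℂ} (hh : Integrable h μ)
    (n : ℤ) : Integrable (fun ζ => zetaPow n ζ * h ζ) μ :=
  memLp_one_iff_integrable.1 (memLp_zetaPow_mul (memLp_one_iff_integrable.2 hh) n)

theorem coef_congr {μ : Measure Circle} {g h : Circle → ℂ} (e : g =ᵐ[μ] h) (n : ℤ) :
    coef μ g n = coef μ h n :=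
  integral_congr_ae (e.mono fun ζ hζ => by simp only [hζ])

theorem coef_add {μ : Measure Circle} {g h : Circle → ℂ} (hg : Integrable g μ)
    (hh : Integrable h μ) (n : ℤ) :
    coef μ (fun ζ => g ζ + h ζ) n = coef μ g n + coef μ h n := by
  simp only [coef, mul_add]
  exact integral_add (integrable_zetaPow_mul hg _) (integrable_zetaPow_mul hh _)

theorem coef_sub {μ : Measure Circle} {g h : Circle → ℂ} (hg : Integrable g μ)
    (hh : Integrable h μ) (n : ℤ) :
    coef μ (fun ζ => g ζ - h ζ) n = coef μ g n - coef μ h n := by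
  simp only [coef, mul_sub]
  exact integral_sub (integrable_zetaPow_mul hg _) (integrable_zetaPow_mul hh _)

theorem coef_const_mul (μ : Measure Circle) (c : ℂ) (h : Circle → ℂ) (n : ℤ) :
    coef μ (fun ζ => c * h ζ) n = c * coef μ h n := by
  simp only [coef, mul_left_comm _ c]
  exact integral_const_mul c _

theorem coef_zetaPow_mul (μ : Measure Circle) (h : Circle → ℂ) (j n : ℤ) :
    coef μ (fun ζ => zetaPow j ζ * h ζ) n = coef μ h (n - j) := by
  simp only [coef, ← mul_assoc, zetaPow_mul]
  rw [neg_sub, sub_eq_add_neg, add_comm j]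

theorem coef_indicator (μ : Measure Circle) {E : Set Circle} (hE : MeasurableSet E)
    (h : Circle → ℂ) (n : ℤ) : coef μ (E.indicator h) n = coef (μ.restrict E) h n := by
  rw [coef, coef, ← integral_indicator hE]
  congr 1
  ext ζ
  by_cases hζ : ζ ∈ E <;> simp [hζ]

section Coef

variable {μ : Measure Circle} [IsFiniteMeasure μ]

/-- The character `ζ ↦ ζ ^ n` as an element of `L²(μ)`. -/
def zetaPowLp (μ : Measure Circle) [IsFiniteMeasure μ] (n : ℤ) : Lp ℂ 2 μ :=
  ContinuousMap.toLp 2 μ ℂ (zetaPow n)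

theorem coeFn_zetaPowLp (n : ℤ) : zetaPowLp μ n =ᵐ[μ] zetaPow n :=
  ContinuousMap.coeFn_toLp (p := 2) (𝕜 := ℂ) μ (zetaPow n)

theorem polyLp_X_pow (n : ℕ) : polyLp μ (X ^ n) = zetaPowLp μ n := by
  simp [polyLp, zetaPowLp, zetaPow_natCast]

theorem coef_eq_inner (h : Lp ℂ 2 μ) (n : ℤ) : coef μ h n = ⟪zetaPowLp μ n, h⟫_ℂ := by
  rw [L2.inner_def]
  refine integral_congr_ae ?_
  filter_upwards [coeFn_zetaPowLp (μ := μ) n] with ζ hζ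
  rw [hζ, RCLike.inner_apply, conj_zetaPow, mul_comm]

theorem integrable_of_memLp_two {h : Circle → ℂ} (hh : MemLp h 2 μ) : Integrable h μ :=
  hh.integrable one_le_two

/-- A finite measure on the circle is determined by its Fourier coefficients. -/
theorem measure_ext_fourier {ρ σ : Measure Circle} [IsFiniteMeasure ρ] [IsFiniteMeasure σ]
    (h : ∀ n : ℤ, ∫ ζ, zetaPow n ζ ∂ρ = ∫ ζ, zetaPow n ζ ∂σ) : ρ = σ := by
  have key : ∀ (τ : Measure Circle) [IsFiniteMeasure τ], ∃ S : C(Circle, ℂ) →L[ℂ] ℂ,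
      ∀ f, S f = ∫ ζ, f ζ ∂τ := by
    intro τ _
    -- Integration is the inner product with the constant `1` in `L²(τ)`, which makes it a
    -- continuous functional on `C(𝕋)`.
    refine ⟨(innerSL ℂ (zetaPowLp τ 0)).comp (ContinuousMap.toLp 2 τ ℂ), fun f => ?_⟩
    have h1 := coef_eq_inner (ContinuousMap.toLp 2 τ ℂ f) 0
    rw [coef_congr (ContinuousMap.coeFn_toLp (p := 2) (𝕜 := ℂ) τ f)] at h1
    refine h1.symm.trans ?_
    simp [coef, zetaPow_zero]
  obtain ⟨S, hS⟩ := key ρ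
  obtain ⟨T, hT⟩ := key σ
  have hST : S = T := clm_ext_zetaPow fun n => by rw [hS, hT, h]
  refine ext_of_forall_integral_eq_of_IsFiniteMeasure fun f => ?_
  let g : C(Circle, ℂ) := ⟨fun ζ => (f ζ : ℂ), Complex.continuous_ofReal.comp f.continuous⟩
  have := (hS g).symm.trans ((congrArg (fun R => R g) hST).trans (hT g))
  change ∫ ζ, ((f ζ : ℝ) : ℂ) ∂ρ = ∫ ζ, ((f ζ : ℝ) : ℂ) ∂σ at this
  rw [integral_complex_ofReal, integral_complex_ofReal] at this
  exact_mod_cast this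

/-- An `L²(μ)` function all of whose Fourier coefficients vanish is zero. -/
theorem Lp_eq_zero_of_coef (y : Lp ℂ 2 μ) (h : ∀ n : ℤ, coef μ y n = 0) : y = 0 := by
  have hS : (innerSL ℂ y).comp (ContinuousMap.toLp 2 μ ℂ) = 0 := by
    refine clm_ext_zetaPow fun n => ?_
    have := h n
    rw [coef_eq_inner, inner_eq_zero_symm] at this
    simpa [zetaPowLp] using this
  have hd : DenseRange (ContinuousMap.toLp 2 μ ℂ : C(Circle, ℂ) →L[ℂ] Lp ℂ 2 μ) :=
    ContinuousMap.toLp_denseRange ℂ μ ℂ (by norm_num)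
  have h0 : innerSL ℂ y = 0 := by
    refine ContinuousLinearMap.coeFn_injective ?_
    refine hd.equalizer (innerSL ℂ y).continuous continuous_const ?_
    ext f
    exact congrArg (fun R => R f) hS
  have := congrArg (fun R => R y) h0
  simpa using this

theorem ae_eq_zero_of_coef {y : Circle → ℂ} (hy : MemLp y 2 μ) (h : ∀ n : ℤ, coef μ y n = 0) :
    y =ᵐ[μ] 0 := by
  have := Lp_eq_zero_of_coef (hy.toLp y) fun n => by rw [coef_congr hy.coeFn_toLp, h]
  exact hy.coeFn_toLp.symm.trans (this ▸ Lp.coeFn_zero ℂ 2 μ)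

theorem mem_H2_orthogonal {y : Lp ℂ 2 μ} : y ∈ (H2 μ)ᗮ ↔ ∀ n : ℕ, coef μ y n = 0 := by
  rw [H2, Submodule.orthogonal_closure, Submodule.mem_orthogonal]
  constructor
  · intro h n
    rw [coef_eq_inner, ← polyLp_X_pow]
    exact h _ ⟨_, rfl⟩
  · rintro h _ ⟨p, rfl⟩
    induction p using Polynomial.induction_on' with
    | add p q hp hq => rw [map_add, inner_add_left, hp, hq, add_zero]
    | monomial n c =>
      rw [← Polynomial.smul_X_eq_monomial, map_smul, inner_smul_left, polyLp_X_pow,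
        ← coef_eq_inner, h, mul_zero]

/-- The bipolar description of the closed space `H²(μ)`; membership is always tested through it. -/
theorem mem_H2_iff {h : Lp ℂ 2 μ} :
    h ∈ H2 μ ↔ ∀ y : Lp ℂ 2 μ, (∀ n : ℕ, coef μ y n = 0) → ⟪y, h⟫_ℂ = 0 := by
  rw [← Submodule.orthogonal_orthogonal (H2 μ), Submodule.mem_orthogonal]
  simp only [mem_H2_orthogonal]

/-- The orthogonal projection onto `H²(μ)` does not change the coefficients of index `n ≥ 0`. -/
theorem exists_H2_coef_eq {h : Circle → ℂ} (hh : MemLp h 2 μ) :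
    ∃ g : H2 μ, ∀ n : ℕ, coef μ (g : Lp ℂ 2 μ) n = coef μ h n := by
  refine ⟨(H2 μ).orthogonalProjectionOnto (hh.toLp h), fun n => ?_⟩
  have h1 : hh.toLp h - (H2 μ).orthogonalProjectionOnto (hh.toLp h) ∈ (H2 μ)ᗮ :=
    (H2 μ).sub_starProjection_mem_orthogonal _
  have h2 := mem_H2_orthogonal.1 h1 n
  rw [coef_eq_inner, inner_sub_right, sub_eq_zero, ← coef_eq_inner, ← coef_eq_inner,
    coef_congr hh.coeFn_toLp] at h2
  exact h2.symm

/-! ### Cauchy transforms and coefficients -/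

theorem cauchyFun_congr {μ : Measure Circle} {g h : Circle → ℂ} (e : g =ᵐ[μ] h) :
    cauchyFun μ g = cauchyFun μ h := by
  ext z
  exact integral_congr_ae (e.mono fun ζ hζ => by simp only [hζ])

/-- Expand the Szegő kernel in powers of `z̄ζ`; the series converges uniformly on the circle, hence
in `L²(μ)`. -/
theorem hasSum_cauchyFun {h : Circle → ℂ} (hh : MemLp h 2 μ) (z : 𝔻) :
    HasSum (fun n : ℕ => (z : ℂ) ^ n * coef μ h n) (cauchyFun μ h z) := by
  have h1 := ((hasSum_szego z).mapL (ContinuousMap.toLp 2 μ ℂ)).mapL (innerSL ℂ (hh.toLp h))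
  have h3 := h1.star
  have e1 : star ((innerSL ℂ (hh.toLp h)) (ContinuousMap.toLp 2 μ ℂ (szego z))) =
      cauchyFun μ h z := by
    rw [← cauchyFun_congr hh.coeFn_toLp, cauchyFun_eq_inner]
    exact inner_conj_symm (𝕜 := ℂ) (ContinuousMap.toLp 2 μ ℂ (szego z)) (hh.toLp h)
  rw [e1] at h3
  refine (congrArg (fun F => HasSum F (cauchyFun μ h z)) (funext fun n => ?_)).mp h3
  rw [← coef_congr hh.coeFn_toLp, coef_eq_inner, zetaPowLp, zetaPow_natCast]
  simp only [innerSL_apply_apply, map_smul, smul_eq_mul, star_mul']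
  rw [show star ⟪hh.toLp h, ContinuousMap.toLp 2 μ ℂ (zeta ^ n)⟫_ℂ =
    ⟪ContinuousMap.toLp 2 μ ℂ (zeta ^ n), hh.toLp h⟫_ℂ from inner_conj_symm _ _]
  simp

/-- Uniqueness of Taylor coefficients. This turns every question about the function spaces into one
about one-sided Fourier coefficients. -/
theorem cauchyFun_eq_iff {lam : Measure Circle} [IsFiniteMeasure lam] {h k : Circle → ℂ}
    (hh : MemLp h 2 μ) (hk : MemLp k 2 lam) :
    cauchyFun μ h = cauchyFun lam k ↔ ∀ n : ℕ, coef μ h n = coef lam k n := by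
  constructor
  · intro e
    have hp : HasFPowerSeriesAt (0 : ℂ → ℂ)
        (FormalMultilinearSeries.ofScalars ℂ fun n : ℕ => coef μ h n - coef lam k n) 0 := by
      rw [hasFPowerSeriesAt_iff]
      filter_upwards [Metric.ball_mem_nhds (0 : ℂ) one_pos] with z hz
      have := (hasSum_cauchyFun hh ⟨z, hz⟩).sub (hasSum_cauchyFun hk ⟨z, hz⟩)
      rw [e, sub_self] at this
      simp only [FormalMultilinearSeries.coeff_ofScalars, smul_eq_mul, Pi.zero_apply, mul_sub]
      exact this
    intro n
    have := congrArg (fun p => FormalMultilinearSeries.coeff p n) hp.eq_zero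
    simp only [FormalMultilinearSeries.coeff_ofScalars] at this
    exact sub_eq_zero.1 this
  · intro e
    ext z
    have h1 := hasSum_cauchyFun hh z
    simp only [e] at h1
    exact h1.unique (hasSum_cauchyFun hk z)

/-- Every Cauchy transform of an `L²(μ)` function belongs to `ℋ⁺(μ)`. -/
theorem mem_range_toFunₗ {F : 𝔻 → ℂ} :
    F ∈ LinearMap.range (HPlus.toFunₗ μ) ↔ ∃ h, MemLp h 2 μ ∧ cauchyFun μ h = F := by
  constructor
  · rintro ⟨f, rfl⟩
    obtain ⟨g, rfl⟩ := (cauchyU μ).surjective f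
    exact ⟨_, Lp.memLp (g : Lp ℂ 2 μ), rfl⟩
  · rintro ⟨h, hh, rfl⟩
    obtain ⟨g, hg⟩ := exists_H2_coef_eq hh
    exact ⟨cauchyU μ g, (cauchyFun_eq_iff (Lp.memLp _) hh).2 hg⟩

theorem coe_cauchyU (g : H2 μ) : (cauchyU μ g : 𝔻 → ℂ) = cauchyFun μ (g : Lp ℂ 2 μ) := rfl

theorem HPlus.coe_injective : Function.Injective (fun f : HPlus μ => (f : 𝔻 → ℂ)) :=
  Subtype.val_injective

theorem cauchyU_mem_intSpace {lam : Measure Circle} [IsFiniteMeasure lam] {g : H2 μ} :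
    cauchyU μ g ∈ intSpace μ lam ↔
      ∃ k, MemLp k 2 lam ∧ ∀ n : ℕ, coef μ (g : Lp ℂ 2 μ) n = coef lam k n := by
  change HPlus.toFunₗ μ (cauchyU μ g) ∈ LinearMap.range (HPlus.toFunₗ lam) ↔ _
  rw [mem_range_toFunₗ]
  refine exists_congr fun k => and_congr_right fun hk => ?_
  rw [← cauchyFun_eq_iff (Lp.memLp _) hk, eq_comm]
  rfl

end Coef

/-! ### Constants in `ℋ⁺(λ)` -/

/-- The constant functions belong to `ℋ⁺(λ)`. -/
def ContainsConst (lam : Measure Circle) : Prop :=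
  ∃ k, MemLp k 2 lam ∧ coef lam k 0 ≠ 0 ∧ ∀ n : ℕ, coef lam k (n + 1 : ℕ) = 0

section Shift

variable {μ : Measure Circle} [IsFiniteMeasure μ]

theorem coeFn_mulZeta {μ : Measure Circle} (h : Lp ℂ 2 μ) : mulZeta μ h =ᵐ[μ] fun ζ => zetaPow 1 ζ * h ζ := by
  have h1 : mulZeta μ h =ᵐ[μ] fun ζ : Circle => (ζ : ℂ) * h ζ :=
    MemLp.coeFn_toLp (memLp_zeta_mul h)
  simpa only [zetaPow_one] using h1

theorem coef_mulZeta {μ : Measure Circle} (h : Lp ℂ 2 μ) (n : ℤ) : coef μ (mulZeta μ h) n = coef μ h (n - 1) := by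
  rw [coef_congr (coeFn_mulZeta h), coef_zetaPow_mul]

theorem V_cauchyU (g : H2 μ) : V μ (cauchyU μ g) = cauchyU μ (Z μ g) := by
  change cauchyU μ (Z μ ((cauchyU μ).symm (cauchyU μ g))) = _
  rw [LinearIsometryEquiv.symm_apply_apply]

theorem coe_Z (g : H2 μ) : (Z μ g : Lp ℂ 2 μ) = mulZeta μ g := rfl

theorem zetaPowLp_mem_H2 (n : ℕ) : zetaPowLp μ n ∈ H2 μ :=
  subset_closure ⟨X ^ n, polyLp_X_pow n⟩

/-- The adjoint of `V_μ` is the backward shift. -/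
theorem coef_adjoint_V (g : H2 μ) (n : ℕ) :
    coef μ ((cauchyU μ).symm (ContinuousLinearMap.adjoint (V μ) (cauchyU μ g)) : Lp ℂ 2 μ) n =
      coef μ (g : Lp ℂ 2 μ) (n + 1 : ℕ) := by
  let p : H2 μ := ⟨zetaPowLp μ n, zetaPowLp_mem_H2 n⟩
  have h1 : mulZeta μ (zetaPowLp μ n) = zetaPowLp μ (n + 1 : ℕ) := by
    rw [← polyLp_X_pow, ← polyLp_X_pow, mulZeta_polyLp, pow_succ']
  have h2 := ContinuousLinearMap.adjoint_inner_right (V μ) (cauchyU μ p) (cauchyU μ g)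
  rw [V_cauchyU, inner_cauchyU, coe_Z, h1, ← coef_eq_inner] at h2
  rw [← h2, coef_eq_inner]
  conv_rhs => rw [← (cauchyU μ).apply_symm_apply
    (ContinuousLinearMap.adjoint (V μ) (cauchyU μ g)), inner_cauchyU]

/-- If the constants belong to `ℋ⁺(λ)`, then the intersection space is reducing. -/
theorem isReducing_of_containsConst {lam : Measure Circle} [IsFiniteMeasure lam]
    (hc : ContainsConst lam) : IsReducing (V μ) (intSpace μ lam) := by
  obtain ⟨k₀, hk₀, h0, h1⟩ := hc
  intro f hf
  obtain ⟨g, rfl⟩ := (cauchyU μ).surjective f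
  obtain ⟨k, hk, e⟩ := cauchyU_mem_intSpace.1 hf
  constructor
  · rw [V_cauchyU, cauchyU_mem_intSpace]
    have hk1 := memLp_zetaPow_mul hk 1
    -- The pair `ζg`, `ζk` agrees at every index `n ≥ 1`; at index `0` the defect is that of `g`,
    -- `k` at index `-1`, and `c k₀` cancels it.
    set c : ℂ := (coef μ (g : Lp ℂ 2 μ) (-1) - coef lam k (-1)) / coef lam k₀ 0 with hcdef
    refine ⟨fun ζ => zetaPow 1 ζ * k ζ + c * k₀ ζ, hk1.add (hk₀.const_mul c), fun n => ?_⟩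
    rw [coef_add (integrable_of_memLp_two hk1) (integrable_of_memLp_two (hk₀.const_mul c)),
      coef_zetaPow_mul, coef_const_mul, coe_Z, coef_mulZeta]
    cases n with
    | zero =>
      rw [hcdef, Nat.cast_zero, div_mul_cancel₀ _ h0]
      simp
    | succ n =>
      rw [h1, mul_zero, add_zero]
      simpa using e n
  · rw [← (cauchyU μ).apply_symm_apply (ContinuousLinearMap.adjoint (V μ) (cauchyU μ g)),
      cauchyU_mem_intSpace]
    -- The backward shift discards the coefficient of index `0`, so no correction is needed here.
    refine ⟨fun ζ => zetaPow (-1) ζ * k ζ, memLp_zetaPow_mul hk _, fun n => ?_⟩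
    rw [coef_adjoint_V, coef_zetaPow_mul, e]
    simp

/-! ### Measures of analytic type -/

/-- Multiplication by `ζ` as a unitary of `L²(μ)`. -/
def mulZetaU (μ : Measure Circle) [IsFiniteMeasure μ] : Lp ℂ 2 μ ≃ₗᵢ[ℂ] Lp ℂ 2 μ :=
  LinearIsometryEquiv.ofSurjective (mulZeta μ) fun h => by
    have hm := memLp_zetaPow_mul (Lp.memLp h) (-1)
    refine ⟨hm.toLp _, Lp.ext ?_⟩
    filter_upwards [coeFn_mulZeta (hm.toLp _), hm.coeFn_toLp] with ζ h1 h2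
    rw [h1, h2, ← mul_assoc, zetaPow_mul]
    simp [zetaPow_zero]

theorem coeFn_mulZetaU_symm (h : Lp ℂ 2 μ) :
    (mulZetaU μ).symm h =ᵐ[μ] fun ζ => zetaPow (-1) ζ * h ζ := by
  have h1 : mulZeta μ ((mulZetaU μ).symm h) = h := (mulZetaU μ).apply_symm_apply h
  have h2 := coeFn_mulZeta ((mulZetaU μ).symm h)
  rw [h1] at h2
  filter_upwards [h2] with ζ h3
  rw [h3, ← mul_assoc, zetaPow_mul]
  simp [zetaPow_zero]

theorem coeFn_mulZetaU_symm_iterate (h : Lp ℂ 2 μ) (n : ℕ) :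
    ((mulZetaU μ).symm)^[n] h =ᵐ[μ] fun ζ => zetaPow (-n) ζ * h ζ := by
  induction n with
  | zero => simp [zetaPow_zero]
  | succ n ih =>
    rw [Function.iterate_succ_apply']
    filter_upwards [ih, coeFn_mulZetaU_symm ((mulZetaU μ).symm^[n] h)] with ζ h1 h2
    rw [h2, h1, ← mul_assoc, zetaPow_mul]
    congr 2
    push_cast
    ring_nf

theorem coeFn_mulZetaU_iterate (h : Lp ℂ 2 μ) (n : ℕ) :
    (mulZetaU μ)^[n] h =ᵐ[μ] fun ζ => zetaPow n ζ * h ζ := by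
  induction n with
  | zero => simp [zetaPow_zero]
  | succ n ih =>
    rw [Function.iterate_succ_apply']
    filter_upwards [ih, coeFn_mulZeta ((mulZetaU μ)^[n] h)] with ζ h1 h2
    refine h2.trans ?_
    rw [h1, ← mul_assoc, zetaPow_mul]
    congr 2
    push_cast
    ring_nf

/-- A vector of a pure invariant subspace that is orthogonal to all translates of the wandering
subspace is zero. -/
theorem eq_zero_of_orthogonal_wandering {E : Type*} [NormedAddCommGroup E]
    [InnerProductSpace ℂ E] (U : E ≃ₗᵢ[ℂ] E) (N : Submodule ℂ E)
    [N.HasOrthogonalProjection] (hN : ∀ x ∈ N, U.symm x ∈ N)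
    (hpure : ∀ x, (∀ n : ℕ, U^[n] x ∈ N) → x = 0) {x : E} (hx : x ∈ N)
    (hw : ∀ w ∈ N, (∀ v ∈ N, ⟪w, U.symm v⟫_ℂ = 0) → ∀ n : ℕ, ⟪U.symm^[n] w, x⟫_ℂ = 0) :
    x = 0 := by
  have step : ∀ x ∈ N,
      (∀ w ∈ N, (∀ v ∈ N, ⟪w, U.symm v⟫_ℂ = 0) → ∀ n : ℕ, ⟪U.symm^[n] w, x⟫_ℂ = 0) →
      U x ∈ N ∧
      ∀ w ∈ N, (∀ v ∈ N, ⟪w, U.symm v⟫_ℂ = 0) → ∀ n : ℕ, ⟪U.symm^[n] w, U x⟫_ℂ = 0 := by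
    intro x hx hw
    constructor
    -- With `K = U⁻¹N`, the component of `x` orthogonal to `K` is a wandering vector. As `x` is
    -- orthogonal to it, `x ∈ U⁻¹N`.
    · let K : Submodule ℂ E := N.map (U.symm.toLinearEquiv : E →ₗ[ℂ] E)
      have hKN : K ≤ N := by
        rintro _ ⟨v, hv, rfl⟩
        exact hN v hv
      set a := K.starProjection x with ha
      have haK : a ∈ K := K.starProjection_apply_mem x
      have hb : x - a ∈ Kᗮ := K.sub_starProjection_mem_orthogonal x
      have h1 : ⟪x - a, x⟫_ℂ = 0 :=
        hw (x - a) (N.sub_mem hx (hKN haK))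
          (fun v hv => Submodule.inner_left_of_mem_orthogonal
            (Submodule.mem_map_of_mem (f := (U.symm.toLinearEquiv : E →ₗ[ℂ] E)) hv) hb) 0
      have h2 : ⟪x - a, a⟫_ℂ = 0 := Submodule.inner_left_of_mem_orthogonal haK hb
      have h3 : ⟪x - a, x - a⟫_ℂ = 0 := by rw [inner_sub_right, h1, h2, sub_zero]
      have h4 : x = a := sub_eq_zero.1 (inner_self_eq_zero.1 h3)
      obtain ⟨v, hv, hva⟩ := haK
      have h5 : U x = v := by
        rw [h4, ← hva]
        exact U.apply_symm_apply v
      rw [h5]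
      exact hv
    · intro w hwN hwv n
      have := hw w hwN hwv (n + 1)
      rwa [Function.iterate_succ_apply', ← U.inner_map_map, U.apply_symm_apply] at this
  refine hpure x fun n => ?_
  suffices h : U^[n] x ∈ N ∧ ∀ w ∈ N, (∀ v ∈ N, ⟪w, U.symm v⟫_ℂ = 0) →
      ∀ m : ℕ, ⟪U.symm^[m] w, U^[n] x⟫_ℂ = 0 from h.1
  induction n with
  | zero => exact ⟨hx, hw⟩
  | succ n ih =>
    rw [Function.iterate_succ_apply']
    exact step _ ih.1 ih.2

/-- Two measures with only the zeroth Fourier coefficient are proportional. -/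
theorem smul_measure_eq_of_fourier {ρ σ : Measure Circle} [IsFiniteMeasure ρ] [IsFiniteMeasure σ]
    (hρ : ∀ n : ℕ, ∫ ζ, zetaPow (n + 1 : ℕ) ζ ∂ρ = 0)
    (hσ : ∀ n : ℕ, ∫ ζ, zetaPow (n + 1 : ℕ) ζ ∂σ = 0) :
    (σ Set.univ).toNNReal • ρ = (ρ Set.univ).toNNReal • σ := by
  -- For a positive measure, the coefficients at `n` and `-n` are conjugate.
  have key : ∀ τ : Measure Circle, (∀ n : ℕ, ∫ ζ, zetaPow (n + 1 : ℕ) ζ ∂τ = 0) →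
      ∀ n : ℤ, n ≠ 0 → ∫ ζ, zetaPow n ζ ∂τ = 0 := by
    intro τ hτ n hn
    rcases Int.eq_nat_or_neg n with ⟨m, rfl | rfl⟩
    · obtain ⟨m, rfl⟩ := Nat.exists_eq_succ_of_ne_zero (n := m) (by simpa using hn)
      exact hτ m
    · obtain ⟨m, rfl⟩ := Nat.exists_eq_succ_of_ne_zero (n := m) (by simpa using hn)
      simp only [← conj_zetaPow]
      rw [integral_conj, hτ m, map_zero]
  refine measure_ext_fourier fun n => ?_
  rw [integral_smul_nnreal_measure, integral_smul_nnreal_measure]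
  rcases eq_or_ne n 0 with rfl | hn
  · simp only [zetaPow_zero, integral_const, NNReal.smul_def, Complex.real_smul, Measure.real,
      ENNReal.coe_toNNReal_eq_toReal, mul_one]
    rw [mul_comm]
  · rw [key ρ hρ n hn, key σ hσ n hn, smul_zero, smul_zero]

/-- The measure `|w|² μ`. -/
def sqMeasure (μ : Measure Circle) [IsFiniteMeasure μ] (w : Lp ℂ 2 μ) : Measure Circle :=
  μ.withDensity fun ζ => ((‖w ζ‖₊ ^ 2 : NNReal) : ℝ≥0∞)

instance (w : Lp ℂ 2 μ) : IsFiniteMeasure (sqMeasure μ w) := by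
  refine isFiniteMeasure_withDensity ?_
  have h := (Lp.memLp w).eLpNorm_lt_top
  rw [eLpNorm_lt_top_iff_lintegral_rpow_enorm_lt_top (by norm_num) (by norm_num)] at h
  convert h.ne using 3 with ζ
  simp [enorm]

/-- Makes the Fourier coefficients of `|w|²μ` the correlations of `w` with its translates, so that
wandering vectors give multiples of Lebesgue measure. -/
theorem integral_zetaPow_sqMeasure {w w' : Lp ℂ 2 μ} {n : ℤ}
    (e : w' =ᵐ[μ] fun ζ => zetaPow n ζ * w ζ) :
    ∫ ζ, zetaPow n ζ ∂(sqMeasure μ w) = ⟪w, w'⟫_ℂ := by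
  rw [sqMeasure, integral_withDensity_eq_integral_smul₀
    ((Lp.aestronglyMeasurable w).nnnorm.aemeasurable.pow_const 2), L2.inner_def]
  refine integral_congr_ae ?_
  filter_upwards [e] with ζ h1
  rw [h1, RCLike.inner_apply, mul_assoc, Complex.mul_conj, NNReal.smul_def, Complex.real_smul,
    Complex.normSq_eq_norm_sq]
  push_cast
  rw [mul_comm]

theorem ae_eq_zero_of_sqMeasure {w : Lp ℂ 2 μ} {S : Set Circle} (hS : MeasurableSet S)
    (h : sqMeasure μ w S = 0) : ∀ᵐ ζ ∂μ, ζ ∈ S → w ζ = 0 := by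
  rw [sqMeasure, withDensity_apply _ hS, lintegral_eq_zero_iff' (by
    exact ((Lp.aestronglyMeasurable w).nnnorm.aemeasurable.pow_const 2).coe_nnreal_ennreal.restrict)]
    at h
  filter_upwards [(ae_restrict_iff' hS).1 h] with ζ h1 h2
  simpa using h1 h2

theorem inner_eq_zero_of_ae {μ : Measure Circle} {f g : Lp ℂ 2 μ} (h : ∀ᵐ ζ ∂μ, f ζ = 0 ∨ g ζ = 0) :
    ⟪f, g⟫_ℂ = 0 := by
  rw [L2.inner_def]
  refine integral_eq_zero_of_ae ?_
  filter_upwards [h] with ζ h1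
  rcases h1 with h1 | h1 <;> simp [h1]

/-- The inner product of `y` with `1_S y` is `‖1_S y‖²`. -/
theorem ae_eq_zero_of_inner_indicator {μ : Measure Circle} {y : Lp ℂ 2 μ} {S : Set Circle}
    (hm : MemLp (S.indicator y) 2 μ) (h1 : ⟪y, hm.toLp _⟫_ℂ = 0) :
    ∀ᵐ ζ ∂μ, ζ ∈ S → y ζ = 0 := by
  have hge := hm.coeFn_toLp
  have h2 : ⟪y - hm.toLp _, hm.toLp _⟫_ℂ = 0 := by
    refine inner_eq_zero_of_ae ?_
    filter_upwards [hge, Lp.coeFn_sub y (hm.toLp _)] with ζ e1 e2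
    by_cases hζ : ζ ∈ S
    · left
      rw [e2, Pi.sub_apply, e1, Set.indicator_of_mem hζ, sub_self]
    · right
      rw [e1, Set.indicator_of_notMem hζ]
  rw [inner_sub_left, h1, zero_sub, neg_eq_zero, inner_self_eq_zero] at h2
  have h3 : hm.toLp _ =ᵐ[μ] 0 := h2 ▸ Lp.coeFn_zero ℂ 2 μ
  filter_upwards [hge, h3] with ζ e1 e2 hζ
  rw [e2, Set.indicator_of_mem hζ] at e1
  exact e1.symm

/-- An `L²` form of the F. and M. Riesz theorem: if the coefficients of `y τ` of index `n ≥ 0`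
vanish, then `y` vanishes on every null set of Lebesgue measure. -/
theorem ae_eq_zero_on_null_of_coef {ρ : Measure Circle} [IsFiniteMeasure ρ] (hρ0 : ρ ≠ 0)
    (hρ : ∀ n : ℕ, ∫ ζ, zetaPow (n + 1 : ℕ) ζ ∂ρ = 0) {S : Set Circle} (hS : MeasurableSet S)
    (hρS : ρ S = 0) (y : Lp ℂ 2 μ) (hy : ∀ n : ℕ, coef μ y n = 0) :
    ∀ᵐ ζ ∂μ, ζ ∈ S → y ζ = 0 := by
  set U := mulZetaU μ with hU
  set N : Submodule ℂ (Lp ℂ 2 μ) := (H2 μ)ᗮ with hNdef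
  have hN : ∀ x ∈ N, U.symm x ∈ N := by
    intro x hx
    rw [hNdef, mem_H2_orthogonal] at hx ⊢
    intro n
    rw [coef_congr (coeFn_mulZetaU_symm x), coef_zetaPow_mul]
    simpa using hx (n + 1)
  have hNn : ∀ n : ℕ, ∀ x ∈ N, U.symm^[n] x ∈ N := by
    intro n x hx
    induction n with
    | zero => exact hx
    | succ n ih =>
      rw [Function.iterate_succ_apply']
      exact hN _ ih
  -- That `ζⁿx` annihilates `H²(μ)` for every `n` says, read at index `0`, that the coefficients of
  -- `x` of index `-n` vanish as well.
  have hpure : ∀ x, (∀ n : ℕ, U^[n] x ∈ N) → x = 0 := by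
    intro x hx
    refine Lp_eq_zero_of_coef x fun n => ?_
    rcases Int.eq_nat_or_neg n with ⟨m, rfl | rfl⟩
    · exact mem_H2_orthogonal.1 (hx 0) m
    · have := mem_H2_orthogonal.1 (hx m) 0
      rw [coef_congr (coeFn_mulZetaU_iterate x m), coef_zetaPow_mul] at this
      simpa using this
  have hW : ∀ w ∈ N, (∀ v ∈ N, ⟪w, U.symm v⟫_ℂ = 0) → ∀ᵐ ζ ∂μ, ζ ∈ S → w ζ = 0 := by
    intro w hw hwv
    -- A wandering `w` is orthogonal to `ζ̄ⁿ⁺¹w`, so `|w|²μ` is proportional to `ρ` and does not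
    -- charge `S`.
    have h1 : ∀ n : ℕ, ∫ ζ, zetaPow (n + 1 : ℕ) ζ ∂(sqMeasure μ w) = 0 := by
      intro n
      have h2 := integral_zetaPow_sqMeasure (coeFn_mulZetaU_symm_iterate w (n + 1))
      rw [Function.iterate_succ_apply', hwv _ (hNn n w hw)] at h2
      rw [← map_eq_zero (starRingEnd ℂ), ← integral_conj]
      simpa only [conj_zetaPow] using h2
    have h2 := congrArg (fun σ : Measure Circle => σ S) (smul_measure_eq_of_fourier h1 hρ)
    simp only [Measure.smul_apply, hρS, smul_zero] at h2
    refine ae_eq_zero_of_sqMeasure hS ?_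
    have h3 : (ρ Set.univ).toNNReal ≠ 0 := by
      rw [Ne, ENNReal.toNNReal_eq_zero_iff]
      simp [hρ0]
    have h4 : ((ρ Set.univ).toNNReal : ℝ≥0∞) * sqMeasure μ w S = 0 := h2
    exact (mul_eq_zero.1 h4).resolve_left (by exact_mod_cast h3)
  have hyN : y ∈ N := mem_H2_orthogonal.2 hy
  have hm : MemLp (S.indicator y) 2 μ := (Lp.memLp y).indicator hS
  set g := hm.toLp _ with hg
  have hge : g =ᵐ[μ] S.indicator y := hm.coeFn_toLp
  have hgN : g - N.starProjection g ∈ Nᗮ := N.sub_starProjection_mem_orthogonal g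
  -- All translates of wandering vectors vanish on `S`, while `g = 1_S y` lives on `S`; so the
  -- projection of `g` to `N` is orthogonal to all of them.
  have h0 : N.starProjection g = 0 := by
    refine eq_zero_of_orthogonal_wandering U N hN hpure (N.starProjection_apply_mem g) ?_
    intro w hw hwv n
    have h1 : ⟪U.symm^[n] w, g - N.starProjection g⟫_ℂ = 0 :=
      Submodule.inner_right_of_mem_orthogonal (hNn n w hw) hgN
    have h2 : ⟪U.symm^[n] w, g⟫_ℂ = 0 := by
      refine inner_eq_zero_of_ae ?_
      filter_upwards [hW w hw hwv, coeFn_mulZetaU_symm_iterate w n, hge] with ζ e1 e2 e3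
      by_cases hζ : ζ ∈ S
      · left
        rw [e2, e1 hζ, mul_zero]
      · right
        rw [e3, Set.indicator_of_notMem hζ]
    rw [inner_sub_right, h2, zero_sub, neg_eq_zero] at h1
    exact h1
  rw [h0, sub_zero] at hgN
  have h1 : ⟪y, g⟫_ℂ = 0 := Submodule.inner_right_of_mem_orthogonal hyN hgN
  exact ae_eq_zero_of_inner_indicator hm h1

/-- If the constants belong to `ℋ⁺(λ)`, there is a Lebesgue-like measure dominated by `λ`. -/
theorem exists_lebesgue_of_containsConst {lam : Measure Circle} [IsFiniteMeasure lam]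
    (hc : ContainsConst lam) : ∃ ρ : Measure Circle, IsFiniteMeasure ρ ∧ ρ ≠ 0 ∧ ρ ≪ lam ∧
      ∀ n : ℕ, ∫ ζ, zetaPow (n + 1 : ℕ) ζ ∂ρ = 0 := by
  obtain ⟨k, hk, h0, h1⟩ := hc
  obtain ⟨g, hg⟩ := exists_H2_coef_eq hk
  have hpos : ∀ n : ℕ, ∫ ζ, zetaPow (n + 1 : ℕ) ζ ∂(sqMeasure lam g) = 0 := by
    intro n
    have h2 := integral_zetaPow_sqMeasure
      (coeFn_mulZetaU_symm_iterate (g : Lp ℂ 2 lam) (n + 1))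
    rw [← map_eq_zero (starRingEnd ℂ), ← integral_conj]
    simp only [conj_zetaPow]
    rw [h2, inner_eq_zero_symm]
    -- The coefficients of `g` of positive index vanish, so `ζ̄ⁿ⁺¹g` annihilates `H²(λ)`, which
    -- contains `g`.
    refine mem_H2_iff.1 g.2 _ fun m => ?_
    rw [coef_congr (coeFn_mulZetaU_symm_iterate _ _), coef_zetaPow_mul]
    have := hg (m + n + 1)
    rw [h1] at this
    rw [← this]
    congr 1
  refine ⟨sqMeasure lam g, inferInstance, fun h => h0 ?_, withDensity_absolutelyContinuous _ _,
    hpos⟩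
  have h2 := ae_eq_zero_of_sqMeasure (w := (g : Lp ℂ 2 lam)) MeasurableSet.univ (by rw [h]; rfl)
  have h3 := hg 0
  rw [Nat.cast_zero] at h3
  rw [← h3, coef]
  refine integral_eq_zero_of_ae ?_
  filter_upwards [h2] with ζ e
  simp [e trivial]

end Shift

/-! ### Change of density -/

/-- An `L²(ν)` function, for `ν = w μ` with bounded density `w`, is an `L²(μ)` function after
multiplication by `w`. -/
theorem exists_memLp_of_withDensity {μ ν : Measure Circle} {w : Circle → NNReal}
    (hw : Measurable w) {C : NNReal} (hC : ∀ᵐ ζ ∂μ, w ζ ≤ C)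
    (hν : ν = μ.withDensity fun ζ => (w ζ : ℝ≥0∞)) {h : Circle → ℂ} (hh : MemLp h 2 ν) :
    ∃ y, MemLp y 2 μ ∧ ∀ S, MeasurableSet S → ∀ n : ℤ,
      coef (μ.restrict S) y n = coef (ν.restrict S) h n := by
  -- `h` is measurable only up to a `ν`-null set, which `μ` may charge; a genuinely measurable
  -- representative is needed before passing to `μ`.
  set h' := hh.1.mk h with hh'
  have hsm : StronglyMeasurable h' := hh.1.stronglyMeasurable_mk
  have hae : h =ᵐ[ν] h' := hh.1.ae_eq_mk
  have hmem : MemLp h' 2 ν := hh.ae_eq hae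
  have hsy : StronglyMeasurable fun ζ => (w ζ : ℂ) * h' ζ := by
    refine StronglyMeasurable.mul ?_ hsm
    have : Measurable fun ζ => ((w ζ : ℝ) : ℂ) := by fun_prop
    exact this.stronglyMeasurable
  refine ⟨fun ζ => (w ζ : ℂ) * h' ζ, ?_, fun S hS n => ?_⟩
  · rw [memLp_two_iff_integrable_sq_norm hsm.aestronglyMeasurable, hν,
      integrable_withDensity_iff_integrable_smul hw] at hmem
    rw [memLp_two_iff_integrable_sq_norm hsy.aestronglyMeasurable]
    -- `|wh'|² ≤ C · w|h'|²`, and `w|h'|²` is `μ`-integrable since `h' ∈ L²(ν)`.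
    refine (hmem.const_mul (C : ℝ)).mono (by fun_prop) ?_
    filter_upwards [hC] with ζ hζ
    have h1 : (w ζ : ℝ) ≤ C := hζ
    have h2 : ‖((w ζ : ℝ) : ℂ)‖ = w ζ := by simp
    simp only [NNReal.smul_def, smul_eq_mul]
    rw [norm_mul, h2, Real.norm_of_nonneg (by positivity), Real.norm_of_nonneg (by positivity),
      mul_pow, pow_two (w ζ : ℝ), mul_assoc]
    gcongr
  · rw [coef_congr (ae_restrict_of_ae hae), coef, coef, hν, restrict_withDensity hS,
      integral_withDensity_eq_integral_smul hw]
    refine integral_congr_ae (Filter.Eventually.of_forall fun ζ => ?_)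
    simp only [NNReal.smul_def, Complex.real_smul]
    rw [mul_left_comm]

theorem exists_nnreal_density {μ ν : Measure Circle} [IsFiniteMeasure μ] [IsFiniteMeasure ν]
    (h : ν ≪ μ) : ∃ w : Circle → NNReal, Measurable w ∧
      (ν = μ.withDensity fun ζ => (w ζ : ℝ≥0∞)) ∧ ∀ᵐ ζ ∂μ, (w ζ : ℝ≥0∞) = ν.rnDeriv μ ζ := by
  have hae : ∀ᵐ ζ ∂μ, (((ν.rnDeriv μ ζ).toNNReal : NNReal) : ℝ≥0∞) = ν.rnDeriv μ ζ := by
    filter_upwards [ν.rnDeriv_lt_top μ] with ζ hζ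
    exact ENNReal.coe_toNNReal hζ.ne
  refine ⟨fun ζ => (ν.rnDeriv μ ζ).toNNReal, (ν.measurable_rnDeriv μ).ennreal_toNNReal, ?_, hae⟩
  rw [withDensity_congr_ae hae, Measure.withDensity_rnDeriv_eq ν μ h]

theorem exists_memLp_of_le {μ ν : Measure Circle} [IsFiniteMeasure μ] [IsFiniteMeasure ν]
    (h : ν ≤ μ) {f : Circle → ℂ} (hf : MemLp f 2 ν) :
    ∃ y, MemLp y 2 μ ∧ ∀ S, MeasurableSet S → ∀ n : ℤ,
      coef (μ.restrict S) y n = coef (ν.restrict S) f n := by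
  obtain ⟨w, hw, hν, hae⟩ := exists_nnreal_density h.absolutelyContinuous
  refine exists_memLp_of_withDensity hw (C := 1) ?_ hν hf
  filter_upwards [hae, Measure.rnDeriv_le_one_of_le h] with ζ h1 h2
  rw [← h1, Pi.one_apply] at h2
  exact_mod_cast h2

/-- Truncation of the density of an absolutely continuous measure. -/
theorem exists_truncation {ν lam : Measure Circle} [IsFiniteMeasure ν] [IsFiniteMeasure lam]
    (h : ν ≪ lam) : ∃ A : ℕ → Set Circle, (∀ m, MeasurableSet (A m)) ∧ (⋃ m, A m) = Set.univ ∧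
      ∀ m f, MemLp f 2 ν → ∃ k, MemLp k 2 lam ∧
        ∀ n : ℤ, coef lam k n = coef (ν.restrict (A m)) f n := by
  obtain ⟨w, hw, hν, -⟩ := exists_nnreal_density h
  have hA : ∀ m : ℕ, MeasurableSet {ζ | w ζ ≤ (m : NNReal)} := fun m =>
    measurableSet_le hw measurable_const
  refine ⟨fun m => {ζ | w ζ ≤ (m : NNReal)}, hA, ?_, fun m f hf => ?_⟩
  · refine Set.eq_univ_of_forall fun ζ => Set.mem_iUnion.2 ?_
    exact exists_nat_ge (w ζ)
  · have h1 : ν.restrict {ζ | w ζ ≤ (m : NNReal)} = lam.withDensity fun ζ =>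
        (({ζ | w ζ ≤ (m : NNReal)}.indicator w ζ : NNReal) : ℝ≥0∞) := by
      conv_lhs => rw [hν, restrict_withDensity (hA m), ← withDensity_indicator (hA m)]
      congr 1
      ext ζ
      by_cases hζ : ζ ∈ {ζ | w ζ ≤ (m : NNReal)}
      · rw [Set.indicator_of_mem hζ, Set.indicator_of_mem hζ]
      · rw [Set.indicator_of_notMem hζ, Set.indicator_of_notMem hζ, ENNReal.coe_zero]
    obtain ⟨y, hy, e⟩ := exists_memLp_of_withDensity (hw.indicator (hA m)) (C := (m : NNReal))
      (Filter.Eventually.of_forall fun ζ => by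
        by_cases hζ : ζ ∈ {ζ | w ζ ≤ (m : NNReal)}
        · rw [Set.indicator_of_mem hζ]; exact hζ
        · rw [Set.indicator_of_notMem hζ]; exact zero_le) h1 (hf.restrict _)
    exact ⟨y, hy, fun n => by simpa using e Set.univ MeasurableSet.univ n⟩

/-! ### RK-absolute continuity, and the splitting of `H²(μ)` under the reducing hypothesis. -/

section Split

variable {μ lam : Measure Circle} [IsFiniteMeasure μ] [IsFiniteMeasure lam]

theorem H2_eq_zero_of_coef {x : Lp ℂ 2 μ} (hx : x ∈ H2 μ) (h : ∀ n : ℕ, coef μ x n = 0) :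
    x = 0 :=
  inner_self_eq_zero.1 (mem_H2_iff.1 hx x h)

/-- A measure absolutely continuous with respect to `λ` is RK-absolutely continuous. -/
theorem rkAbsolutelyContinuous_of_absolutelyContinuous (h : μ ≪ lam) :
    RKAbsolutelyContinuous μ lam := by
  obtain ⟨A, hA, hAu, hk⟩ := exists_truncation h
  rw [RKAbsolutelyContinuous, Submodule.dense_iff_topologicalClosure_eq_top,
    Submodule.topologicalClosure_eq_top_iff, Submodule.eq_bot_iff]
  intro f hf
  obtain ⟨g, rfl⟩ := (cauchyU μ).surjective f
  -- The projection `g'` of `1_{A m} g` onto `H²(μ)` gives an element of the intersection space, as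
  -- the density is bounded on `A m`. Since `g ∈ H²(μ)`, orthogonality to `g'` is orthogonality to
  -- `1_{A m} g`.
  have key : ∀ m, ∀ᵐ ζ ∂μ, ζ ∈ A m → (g : Lp ℂ 2 μ) ζ = 0 := by
    intro m
    have hm : MemLp ((A m).indicator (g : Lp ℂ 2 μ)) 2 μ := (Lp.memLp _).indicator (hA m)
    obtain ⟨g', hg'⟩ := exists_H2_coef_eq hm
    obtain ⟨k, hkm, e⟩ := hk m (g : Lp ℂ 2 μ) (Lp.memLp _)
    have h1 : cauchyU μ g' ∈ intSpace μ lam :=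
      cauchyU_mem_intSpace.2 ⟨k, hkm, fun n => by rw [hg', e, coef_indicator _ (hA m)]⟩
    have h2 : ⟪(g : Lp ℂ 2 μ), (g' : Lp ℂ 2 μ)⟫_ℂ = 0 := by
      rw [← inner_cauchyU]
      exact Submodule.inner_left_of_mem_orthogonal h1 hf
    have h3 : ⟪hm.toLp _ - g', (g : Lp ℂ 2 μ)⟫_ℂ = 0 := by
      refine mem_H2_iff.1 g.2 _ fun n => ?_
      rw [coef_eq_inner, inner_sub_right, ← coef_eq_inner, ← coef_eq_inner,
        coef_congr hm.coeFn_toLp, hg', sub_self]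
    rw [inner_eq_zero_symm, inner_sub_right, h2, sub_zero] at h3
    exact ae_eq_zero_of_inner_indicator hm h3
  have h0 : (g : Lp ℂ 2 μ) = 0 := by
    refine Lp.ext (Filter.EventuallyEq.trans ?_ (Lp.coeFn_zero ℂ 2 μ).symm)
    filter_upwards [ae_all_iff.2 key] with ζ hζ
    obtain ⟨m, hm⟩ := Set.mem_iUnion.1 (hAu.ge (Set.mem_univ ζ))
    exact hζ m hm
  rw [show g = 0 from Subtype.ext h0, map_zero]

/-- Without constants in `ℋ⁺(λ)`, reducibility of the intersection space forces the Fourier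
coefficients of negative index to agree as well. -/
theorem coef_eq_of_isReducing (hc : ¬ ContainsConst lam)
    (hred : IsReducing (V μ) (intSpace μ lam)) {g : H2 μ} {k : Circle → ℂ} (hk : MemLp k 2 lam)
    (e : ∀ n : ℕ, coef μ (g : Lp ℂ 2 μ) n = coef lam k n) (n : ℤ) :
    coef μ (g : Lp ℂ 2 μ) n = coef lam k n := by
  have key : ∀ (m : ℕ) (g : H2 μ) (k : Circle → ℂ), MemLp k 2 lam →
      (∀ n : ℕ, coef μ (g : Lp ℂ 2 μ) n = coef lam k n) →
      coef μ (g : Lp ℂ 2 μ) (-m) = coef lam k (-m) := by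
    intro m
    induction m with
    | zero => exact fun g k _ e => by simpa using e 0
    | succ m ih =>
      intro g k hk e
      have hk1 := memLp_zetaPow_mul hk 1
      have h1 := (hred _ (cauchyU_mem_intSpace.2 ⟨k, hk, e⟩)).1
      rw [V_cauchyU, cauchyU_mem_intSpace] at h1
      obtain ⟨k', hk', e'⟩ := h1
      simp only [coe_Z, coef_mulZeta] at e'
      have h2 : coef μ (g : Lp ℂ 2 μ) (-1) = coef lam k (-1) := by
        by_contra hne
        -- If the coefficients at `-1` differed, `k'λ` and `ζkλ` would agree at every index `n ≥ 1`
        -- but not at `0`: a constant in `ℋ⁺(λ)`.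
        refine hc ⟨fun ζ => k' ζ - zetaPow 1 ζ * k ζ, hk'.sub hk1, ?_, fun n => ?_⟩
        · rw [coef_sub (integrable_of_memLp_two hk') (integrable_of_memLp_two hk1),
            coef_zetaPow_mul]
          have := e' 0
          rw [Nat.cast_zero] at this
          rw [← this, sub_ne_zero]
          simpa using hne
        · rw [coef_sub (integrable_of_memLp_two hk') (integrable_of_memLp_two hk1),
            coef_zetaPow_mul, ← e']
          have := e n
          push_cast
          rw [add_sub_cancel_right, this, sub_self]
      -- Now `ζg` and `ζk` agree at all `n ≥ 0`, and their coefficients at `-m` are those of `g` and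
      -- `k` at `-m - 1`.
      have h3 := ih (Z μ g) _ hk1 fun n => by
        rw [coe_Z, coef_mulZeta, coef_zetaPow_mul]
        cases n with
        | zero => simpa using h2
        | succ n => simpa using e n
      rw [coe_Z, coef_mulZeta, coef_zetaPow_mul] at h3
      rw [show (-((m + 1 : ℕ) : ℤ)) = -(m : ℤ) - 1 by push_cast; ring]
      exact h3
  rcases Int.eq_nat_or_neg n with ⟨m, rfl | rfl⟩
  · exact e m
  · exact key m g k hk e

/-- Under the reducing hypothesis, the elements of the intersection space are Cauchy transforms of
functions which vanish on every `λ`-null set. -/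
theorem ae_eq_zero_of_mem_intSpace (hred : IsReducing (V μ) (intSpace μ lam)) {S : Set Circle}
    (hS : MeasurableSet S) (hlS : lam S = 0) {g : H2 μ} {k : Circle → ℂ} (hk : MemLp k 2 lam)
    (e : ∀ n : ℕ, coef μ (g : Lp ℂ 2 μ) n = coef lam k n) :
    (g : Lp ℂ 2 μ) =ᵐ[μ.restrict S] 0 := by
  -- Over the common dominating measure `μ + λ`, the difference `gμ - kλ` has an `L²` density.
  obtain ⟨y₁, hy₁, e₁⟩ := exists_memLp_of_le (Measure.le_add_right le_rfl : μ ≤ μ + lam)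
    (Lp.memLp (g : Lp ℂ 2 μ))
  obtain ⟨y₂, hy₂, e₂⟩ := exists_memLp_of_le (Measure.le_add_left le_rfl : lam ≤ μ + lam) hk
  have hy := hy₁.sub hy₂
  have hcoef : ∀ n : ℤ, coef (μ + lam) (hy.toLp _) n =
      coef μ (g : Lp ℂ 2 μ) n - coef lam k n := by
    intro n
    have h1 := e₁ Set.univ MeasurableSet.univ n
    have h2 := e₂ Set.univ MeasurableSet.univ n
    simp only [Measure.restrict_univ] at h1 h2
    rw [coef_congr hy.coeFn_toLp, ← h1, ← h2]
    exact coef_sub (integrable_of_memLp_two hy₁) (integrable_of_memLp_two hy₂) n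
  have hzero : ∀ᵐ ζ ∂(μ + lam), ζ ∈ S → hy.toLp _ ζ = 0 := by
    by_cases hc : ContainsConst lam
    · obtain ⟨ρ, _, hρ0, hρl, hρ⟩ := exists_lebesgue_of_containsConst hc
      exact ae_eq_zero_on_null_of_coef hρ0 hρ hS (hρl hlS) _ fun n => by
        rw [hcoef, e, sub_self]
    · have h0 := Lp_eq_zero_of_coef (hy.toLp _) fun n => by
        rw [hcoef, coef_eq_of_isReducing hc hred hk e, sub_self]
      filter_upwards [show hy.toLp _ =ᵐ[μ + lam] 0 from h0 ▸ Lp.coeFn_zero ℂ 2 _] with ζ hζ _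
      exact hζ
  refine ae_eq_zero_of_coef ((Lp.memLp _).restrict S) fun n => ?_
  -- The densities agree on `S`, so `gμ` and `kλ` have the same restriction to `S`, which is zero.
  have h3 : coef ((μ + lam).restrict S) y₁ n = coef ((μ + lam).restrict S) y₂ n := by
    refine coef_congr ?_ n
    refine (ae_restrict_iff' hS).2 ?_
    filter_upwards [hzero, hy.coeFn_toLp] with ζ h1 h2 hζ
    rw [h1 hζ] at h2
    exact sub_eq_zero.1 h2.symm
  rw [e₁ S hS, e₂ S hS, Measure.restrict_eq_zero.2 hlS] at h3
  rw [h3, coef, integral_zero_measure]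

/-- Multiplication by the indicator function of `E` leaves `L²(μ) ⊖ H²(μ)` invariant. -/
def Splits (μ : Measure Circle) (E : Set Circle) : Prop :=
  ∀ y : Lp ℂ 2 μ, (∀ n : ℕ, coef μ y n = 0) → ∀ n : ℕ, coef (μ.restrict E) y n = 0

theorem coef_restrict_add_compl {E : Set Circle} (hE : MeasurableSet E) (y : Lp ℂ 2 μ) (n : ℤ) :
    coef (μ.restrict E) y n + coef (μ.restrict Eᶜ) y n = coef μ y n :=
  integral_add_compl hE (integrable_zetaPow_mul (integrable_of_memLp_two (Lp.memLp y)) _)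

theorem Splits.compl {E : Set Circle} (hE : MeasurableSet E) (h : Splits μ E) :
    Splits μ Eᶜ := by
  intro y hy n
  have := coef_restrict_add_compl hE y n
  rwa [h y hy, zero_add, hy] at this

theorem splits_of_isReducing (hred : IsReducing (V μ) (intSpace μ lam)) {E : Set Circle}
    (hE : MeasurableSet E) (hlE : lam Eᶜ = 0) (hac : μ.restrict E ≪ lam) : Splits μ E := by
  intro y hy n
  by_cases hc : ContainsConst lam
  · obtain ⟨ρ, _, hρ0, hρl, hρ⟩ := exists_lebesgue_of_containsConst hc
    -- When constants are present, `y` vanishes off `E`, so restricting to `E` changes nothing.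
    have h0 := ae_eq_zero_on_null_of_coef hρ0 hρ hE.compl (hρl hlE) y hy
    have h1 : coef (μ.restrict Eᶜ) y n = 0 := by
      refine integral_eq_zero_of_ae ?_
      filter_upwards [(ae_restrict_iff' hE.compl).2 h0] with ζ hζ
      simp [hζ]
    have h2 := coef_restrict_add_compl hE y n
    rwa [h1, add_zero, hy] at h2
  · obtain ⟨A, hA, hAu, hk⟩ := exists_truncation hac
    -- Without constants, `y` vanishes on `E`. On `A m ∩ E` the measure `yμ` has the form `kλ`, so
    -- all coefficients of `1_{A m ∩ E} y` agree with those of its projection `g`. Thus it lies in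
    -- `H²(μ)`, to which `y` is orthogonal.
    have key : ∀ m, ∀ᵐ ζ ∂μ, ζ ∈ A m ∩ E → y ζ = 0 := by
      intro m
      have hAE := (hA m).inter hE
      have hm : MemLp ((A m ∩ E).indicator y) 2 μ := (Lp.memLp y).indicator hAE
      obtain ⟨g, hg⟩ := exists_H2_coef_eq hm
      obtain ⟨k, hkm, e⟩ := hk m y ((Lp.memLp y).restrict E)
      have e' : ∀ n : ℤ, coef μ ((A m ∩ E).indicator y) n = coef lam k n := fun n => by
        rw [e, coef_indicator _ hAE, Measure.restrict_restrict (hA m)]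
      have hall := coef_eq_of_isReducing hc hred (g := g) hkm fun n => by rw [hg, e']
      have h1 : hm.toLp _ - g = 0 := Lp_eq_zero_of_coef _ fun n => by
        rw [coef_eq_inner, inner_sub_right, ← coef_eq_inner, ← coef_eq_inner,
          coef_congr hm.coeFn_toLp, hall, e', sub_self]
      refine ae_eq_zero_of_inner_indicator hm ?_
      rw [sub_eq_zero.1 h1]
      exact mem_H2_iff.1 g.2 y hy
    refine integral_eq_zero_of_ae ((ae_restrict_iff' hE).2 ?_)
    filter_upwards [ae_all_iff.2 key] with ζ hζ hζE
    obtain ⟨m, hm⟩ := Set.mem_iUnion.1 (hAu.ge (Set.mem_univ ζ))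
    simp [hζ m ⟨hm, hζE⟩]

/-! ### Inclusions -/

/-- Extension by zero, from `L²(μ|E)` to `L²(μ)`. -/
def extendLp (μ : Measure Circle) {E : Set Circle} (hE : MeasurableSet E) :
    Lp ℂ 2 (μ.restrict E) →ₗᵢ[ℂ] Lp ℂ 2 μ where
  toFun h := ((memLp_indicator_iff_restrict hE).2 (Lp.memLp h)).toLp _
  map_add' f g := by
    rw [← MemLp.toLp_add]
    refine MemLp.toLp_congr _ _ ?_
    filter_upwards [(ae_restrict_iff' hE).1 (Lp.coeFn_add f g)] with ζ hζ
    by_cases h : ζ ∈ E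
    · simpa only [Pi.add_apply, Set.indicator_of_mem h] using hζ h
    · simp [h]
  map_smul' c f := by
    rw [RingHom.id_apply, ← MemLp.toLp_const_smul]
    refine MemLp.toLp_congr _ _ ?_
    filter_upwards [(ae_restrict_iff' hE).1 (Lp.coeFn_smul c f)] with ζ hζ
    by_cases h : ζ ∈ E
    · simp [h, hζ h]
    · simp [h]
  norm_map' f := by
    change ‖((memLp_indicator_iff_restrict hE).2 (Lp.memLp f)).toLp _‖ = ‖f‖
    rw [Lp.norm_toLp, Lp.norm_def, eLpNorm_indicator_eq_eLpNorm_restrict hE]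

theorem coeFn_extendLp {μ : Measure Circle} {E : Set Circle} (hE : MeasurableSet E) (h : Lp ℂ 2 (μ.restrict E)) :
    extendLp μ hE h =ᵐ[μ] E.indicator h :=
  ((memLp_indicator_iff_restrict hE).2 (Lp.memLp h)).coeFn_toLp

/-- By duality: restricting an annihilator of `H²(μ)` to `E` gives an annihilator of `H²(μ|E)`,
because `E` splits. -/
theorem extendLp_mem_H2 {E : Set Circle} (hE : MeasurableSet E) (hs : Splits μ E)
    {h : Lp ℂ 2 (μ.restrict E)} (hh : h ∈ H2 (μ.restrict E)) : extendLp μ hE h ∈ H2 μ := by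
  refine mem_H2_iff.2 fun y hy => ?_
  have hm := (Lp.memLp y).restrict E
  have h1 := mem_H2_iff.1 hh (hm.toLp _) fun n => by rw [coef_congr hm.coeFn_toLp, hs y hy]
  rw [← h1, L2.inner_def, L2.inner_def, ← integral_indicator hE]
  refine integral_congr_ae ?_
  filter_upwards [coeFn_extendLp hE h, (ae_restrict_iff' hE).1 hm.coeFn_toLp] with ζ e1 e2
  rw [e1]
  by_cases hζ : ζ ∈ E
  · simp only [Set.indicator_of_mem hζ]
    rw [e2 hζ]
  · simp [hζ]

/-- If `E` splits `H²(μ)`, then `ℋ⁺(μ|E)` is isometrically contained in `ℋ⁺(μ)`. -/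
theorem exists_isInclusion {E : Set Circle} (hE : MeasurableSet E) (hs : Splits μ E) :
    ∃ e : HPlus (μ.restrict E) →ₗᵢ[ℂ] HPlus μ, IsInclusion e ∧
      ∀ f, ∀ᵐ ζ ∂μ, ζ ∉ E → ((cauchyU μ).symm (e f) : Lp ℂ 2 μ) ζ = 0 := by
  let T : H2 (μ.restrict E) →ₗᵢ[ℂ] H2 μ :=
    { toLinearMap := ((extendLp μ hE).toLinearMap ∘ₗ (H2 (μ.restrict E)).subtype).codRestrict
        (H2 μ) fun h => extendLp_mem_H2 hE hs h.2
      norm_map' := fun h => (extendLp μ hE).norm_map h }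
  refine ⟨(cauchyU μ).toLinearIsometry.comp
    (T.comp (cauchyU (μ.restrict E)).symm.toLinearIsometry), fun f => ?_, fun f => ?_⟩
  · obtain ⟨g, rfl⟩ := (cauchyU (μ.restrict E)).surjective f
    change (cauchyU μ (T ((cauchyU (μ.restrict E)).symm (cauchyU (μ.restrict E) g))) : 𝔻 → ℂ) = _
    rw [LinearIsometryEquiv.symm_apply_apply, coe_cauchyU, coe_cauchyU,
      cauchyFun_eq_iff (Lp.memLp _) (Lp.memLp _)]
    intro n
    rw [← coef_indicator _ hE]
    exact coef_congr (coeFn_extendLp hE (g : Lp ℂ 2 (μ.restrict E))) n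
  · change ∀ᵐ ζ ∂μ, ζ ∉ E → ((cauchyU μ).symm (cauchyU μ
      (T ((cauchyU (μ.restrict E)).symm f))) : Lp ℂ 2 μ) ζ = 0
    rw [LinearIsometryEquiv.symm_apply_apply]
    filter_upwards [coeFn_extendLp hE
      (((cauchyU (μ.restrict E)).symm f : H2 (μ.restrict E)) : Lp ℂ 2 (μ.restrict E))]
      with ζ e1 hζ
    exact e1.trans (Set.indicator_of_notMem hζ _)

theorem range_of_isInclusion {ν : Measure Circle} [IsFiniteMeasure ν]
    {e : HPlus ν →ₗᵢ[ℂ] HPlus μ} (he : IsInclusion e) :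
    LinearMap.range e.toLinearMap = intSpace μ ν := by
  ext f
  rw [mem_intSpace]
  refine exists_congr fun k => ?_
  rw [← he k]
  exact HPlus.coe_injective.eq_iff.symm

/-- Cut `g` into its parts on `E` and `Eᶜ` and project both onto `H²(μ)`; the sum has the
coefficients of `g` at `n ≥ 0`, hence equals `g`. No splitting of `H²(μ)` is required. -/
theorem intSpace_sup_intSpace_compl {E : Set Circle} (hE : MeasurableSet E) :
    intSpace μ (μ.restrict E) ⊔ intSpace μ (μ.restrict Eᶜ) = ⊤ := by
  refine eq_top_iff.2 fun f _ => ?_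
  obtain ⟨g, rfl⟩ := (cauchyU μ).surjective f
  have hp : ∀ F : Set Circle, MeasurableSet F → ∃ g' : H2 μ, ∀ n : ℕ,
      coef μ (g' : Lp ℂ 2 μ) n = coef (μ.restrict F) (g : Lp ℂ 2 μ) n := by
    intro F hF
    obtain ⟨g', hg'⟩ := exists_H2_coef_eq ((Lp.memLp (g : Lp ℂ 2 μ)).indicator hF)
    exact ⟨g', fun n => by rw [hg', coef_indicator _ hF]⟩
  obtain ⟨g₁, h₁⟩ := hp E hE
  obtain ⟨g₂, h₂⟩ := hp Eᶜ hE.compl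
  have h0 : (g₁ + g₂ - g : H2 μ) = 0 := by
    refine Subtype.ext (H2_eq_zero_of_coef (g₁ + g₂ - g).2 fun n => ?_)
    rw [coef_eq_inner, Submodule.coe_sub, Submodule.coe_add, inner_sub_right, inner_add_right,
      ← coef_eq_inner, ← coef_eq_inner, ← coef_eq_inner, h₁, h₂, coef_restrict_add_compl hE,
      sub_self]
  rw [← sub_eq_zero.1 h0, map_add]
  exact Submodule.add_mem_sup
    (cauchyU_mem_intSpace.2 ⟨_, (Lp.memLp (g : Lp ℂ 2 μ)).restrict E, h₁⟩)
    (cauchyU_mem_intSpace.2 ⟨_, (Lp.memLp (g : Lp ℂ 2 μ)).restrict Eᶜ, h₂⟩)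

/-- As `g` vanishes on the `λ`-null set `Eᶜ`, its transform over `μ` is its transform over `μ|E`. -/
theorem intSpace_le_of_isReducing (hred : IsReducing (V μ) (intSpace μ lam)) {E : Set Circle}
    (hE : MeasurableSet E) (hlE : lam Eᶜ = 0) :
    intSpace μ lam ≤ intSpace μ (μ.restrict E) := by
  intro f hf
  obtain ⟨g, rfl⟩ := (cauchyU μ).surjective f
  obtain ⟨k, hk, e⟩ := cauchyU_mem_intSpace.1 hf
  have h0 := ae_eq_zero_of_mem_intSpace hred hE.compl hlE hk e
  refine cauchyU_mem_intSpace.2 ⟨_, (Lp.memLp (g : Lp ℂ 2 μ)).restrict E, fun n => ?_⟩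
  rw [← coef_restrict_add_compl hE, coef_congr h0, add_eq_left]
  simp [coef]

/-- A measure `γ ≤ μ` that is RK-absolutely continuous with respect to `λ` does not charge
`λ`-null sets. -/
theorem measure_compl_eq_zero_of_rkAbsolutelyContinuous
    (hred : IsReducing (V μ) (intSpace μ lam)) {E : Set Circle} (hE : MeasurableSet E)
    (hlE : lam Eᶜ = 0) (hs : Splits μ E) {γ : Measure Circle} [IsFiniteMeasure γ] (hγ : γ ≤ μ)
    (hrk : RKAbsolutelyContinuous γ lam) : γ Eᶜ = 0 := by
  have hm : MemLp (Eᶜ.indicator fun _ => (1 : ℂ)) 2 γ := (memLp_const 1).indicator hE.compl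
  have hφ : ∀ h : Lp ℂ 2 γ, ⟪hm.toLp _, h⟫_ℂ = coef (γ.restrict Eᶜ) h 0 := by
    intro h
    rw [← coef_indicator _ hE.compl, L2.inner_def]
    refine integral_congr_ae ?_
    filter_upwards [hm.coeFn_toLp] with ζ e1
    rw [e1]
    by_cases hζ : ζ ∈ Eᶜ
    · simp only [Set.indicator_of_mem hζ]
      simp [zetaPow_zero]
    · simp only [Set.indicator_of_notMem hζ]
      simp
  have hint : ∀ h : H2 γ, cauchyU γ h ∈ intSpace γ lam →
      coef (γ.restrict Eᶜ) (h : Lp ℂ 2 γ) 0 = 0 := by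
    intro h hh
    obtain ⟨k, hk, e⟩ := cauchyU_mem_intSpace.1 hh
    obtain ⟨y, hy, ey⟩ := exists_memLp_of_le hγ (Lp.memLp (h : Lp ℂ 2 γ))
    obtain ⟨g, hg⟩ := exists_H2_coef_eq hy
    have h0 := ae_eq_zero_of_mem_intSpace hred hE.compl hlE (g := g) hk fun n => by
      have := ey Set.univ MeasurableSet.univ n
      simp only [Measure.restrict_univ] at this
      rw [hg, this, e]
    -- Here `hγ = yμ`, and `g` is the projection of `y` onto `H²(μ)`. The remainder `y - g`
    -- integrates to zero over `Eᶜ` by splitting, and `g` vanishes there by reducibility.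
    have h1 := hs.compl hE (hy.toLp y - g) (fun n => by
      rw [coef_eq_inner, inner_sub_right, ← coef_eq_inner, ← coef_eq_inner,
        coef_congr hy.coeFn_toLp, hg, sub_self]) 0
    rw [Nat.cast_zero] at h1
    rw [← ey _ hE.compl, ← h1]
    refine coef_congr ?_ 0
    filter_upwards [ae_restrict_of_ae hy.coeFn_toLp,
      ae_restrict_of_ae (Lp.coeFn_sub (hy.toLp y) (g : Lp ℂ 2 μ)), h0] with ζ e1 e2 e3
    rw [e2, Pi.sub_apply, e1, e3]
    simp
  have hzero : (fun f : HPlus γ => ⟪hm.toLp _, ((cauchyU γ).symm f : Lp ℂ 2 γ)⟫_ℂ) =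
      fun _ => 0 := by
    refine Continuous.ext_on hrk ?_ continuous_const ?_
    · exact (innerSL ℂ (hm.toLp _)).continuous.comp
        (continuous_subtype_val.comp (cauchyU γ).symm.continuous)
    · intro f hf
      obtain ⟨h, rfl⟩ := (cauchyU γ).surjective f
      simp only [LinearIsometryEquiv.symm_apply_apply]
      rw [hφ]
      exact hint h hf
  -- Evaluation at the constant function `1` gives `γ(Eᶜ)`.
  have h1 := congrFun hzero (cauchyU γ ⟨zetaPowLp γ (0 : ℕ), zetaPowLp_mem_H2 0⟩)
  simp only [LinearIsometryEquiv.symm_apply_apply] at h1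
  rw [hφ, coef_congr (ae_restrict_of_ae (coeFn_zetaPowLp _)), coef] at h1
  simp only [Nat.cast_zero, neg_zero, zetaPow_zero, mul_one, integral_const,
    measureReal_restrict_apply_univ, Complex.real_smul, Complex.ofReal_eq_zero] at h1
  exact (measureReal_eq_zero_iff).1 h1

/-- The Lebesgue decomposition and the decomposition of `ℋ⁺(μ)`, for the measures `μ|E`, `μ|Eᶜ`. -/
theorem decomposition_of_isReducing (hred : IsReducing (V μ) (intSpace μ lam)) {E : Set Circle}
    (hE : MeasurableSet E) (hlE : lam Eᶜ = 0) (hac : μ.restrict E ≪ lam) :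
    (∃ (e : HPlus (μ.restrict E) →ₗᵢ[ℂ] HPlus μ) (j : HPlus (μ.restrict Eᶜ) →ₗᵢ[ℂ] HPlus μ),
      IsInclusion e ∧ IsInclusion j ∧
      LinearMap.range e.toLinearMap ⟂ LinearMap.range j.toLinearMap ∧
      LinearMap.range e.toLinearMap ⊔ LinearMap.range j.toLinearMap = ⊤ ∧
      LinearMap.range e.toLinearMap = (intSpace μ lam).topologicalClosure) ∧
    RKSingular (μ.restrict Eᶜ) lam ∧ RKAbsolutelyContinuous (μ.restrict E) lam ∧
    (∀ (γ : Measure Circle) [IsFiniteMeasure γ],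
      γ ≤ μ → RKAbsolutelyContinuous γ lam → γ ≤ μ.restrict E) := by
  have hs := splits_of_isReducing hred hE hlE hac
  have hrk := rkAbsolutelyContinuous_of_absolutelyContinuous hac
  obtain ⟨e, he, he0⟩ := exists_isInclusion hE hs
  obtain ⟨j, hj, hj0⟩ := exists_isInclusion hE.compl (hs.compl hE)
  have hle : intSpace μ lam ≤ LinearMap.range e.toLinearMap :=
    (range_of_isInclusion he).symm ▸ intSpace_le_of_isReducing hred hE hlE
  have horth : ∀ f f', ⟪e f, j f'⟫_ℂ = 0 := by
    intro f f'
    rw [← (cauchyU μ).apply_symm_apply (e f), ← (cauchyU μ).apply_symm_apply (j f'),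
      inner_cauchyU]
    refine inner_eq_zero_of_ae ?_
    filter_upwards [he0 f, hj0 f'] with ζ h1 h2
    by_cases hζ : ζ ∈ E
    · exact Or.inr (h2 (fun h => h hζ))
    · exact Or.inl (h1 hζ)
  refine ⟨⟨e, j, he, hj, ?_, ?_, ?_⟩, ?_, hrk, fun γ _ hγ hγrk => ?_⟩
  · rw [Submodule.isOrtho_iff_inner_eq]
    rintro _ ⟨f, rfl⟩ _ ⟨f', rfl⟩
    exact horth f f'
  · rw [range_of_isInclusion he, range_of_isInclusion hj]
    exact intSpace_sup_intSpace_compl hE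
  · refine le_antisymm ?_ (Submodule.topologicalClosure_minimal _ hle ?_)
    · rintro _ ⟨f, rfl⟩
      -- The inclusion carries `int(μ|E, λ)`, dense in its space, into `int(μ, λ)`.
      refine map_mem_closure e.continuous (hrk f) fun f' hf' => ?_
      obtain ⟨k, hk⟩ := mem_intSpace.1 hf'
      exact mem_intSpace.2 ⟨k, hk.trans (he f').symm⟩
    · exact (LinearIsometry.isometry e).isClosedEmbedding.isClosed_range
  · refine (Submodule.eq_bot_iff _).2 fun f hf => ?_
    obtain ⟨k, hk⟩ := mem_intSpace.1 hf
    -- A function common to `ℋ⁺(μ|Eᶜ)` and `ℋ⁺(λ)` lies in both of the orthogonal ranges.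
    obtain ⟨f', hf'⟩ := hle (mem_intSpace.2 ⟨k, hk.trans (hj f).symm⟩)
    have h1 := horth f' f
    rw [show e f' = j f from hf', inner_self_eq_zero] at h1
    exact j.injective (h1.trans (map_zero j).symm)
  · have h0 := measure_compl_eq_zero_of_rkAbsolutelyContinuous hred hE hlE hs hγ hγrk
    refine Measure.le_iff.2 fun A hA => ?_
    rw [Measure.restrict_apply hA, ← measure_inter_add_sdiff A hE]
    have h1 : γ (A \ E) = 0 := measure_mono_null (fun x hx => hx.2) h0
    rw [h1, add_zero]
    exact hγ _

end Split

/-! ### The Herglotz–Riesz transform -/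

/-- The Herglotz–Riesz transform, as a function of a complex variable. -/
def herglotzC (lam : Measure Circle) (z : ℂ) : ℂ :=
  ∫ ζ : Circle, (1 + z * conj (ζ : ℂ)) / (1 - z * conj (ζ : ℂ)) ∂lam

theorem herglotz_eq (lam : Measure Circle) (z : 𝔻) : herglotz lam z = herglotzC lam z := rfl

theorem norm_mul_conj_circle (z : ℂ) (ζ : Circle) : ‖z * conj (ζ : ℂ)‖ = ‖z‖ := by
  rw [norm_mul, RCLike.norm_conj, Circle.norm_coe, mul_one]

theorem one_sub_norm_le (z : ℂ) (ζ : Circle) : 1 - ‖z‖ ≤ ‖1 - z * conj (ζ : ℂ)‖ := by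
  have := norm_sub_norm_le (1 : ℂ) (z * conj (ζ : ℂ))
  rwa [norm_one, norm_mul_conj_circle] at this

theorem one_sub_mul_conj_ne_zero {z : ℂ} (hz : ‖z‖ < 1) (ζ : Circle) :
    1 - z * conj (ζ : ℂ) ≠ 0 := by
  have := one_sub_norm_le z ζ
  exact norm_pos_iff.1 (by linarith)

theorem continuous_conj_circle : Continuous fun ζ : Circle => conj (ζ : ℂ) :=
  Complex.continuous_conj.comp continuous_circle_coe

theorem continuous_herglotz_kernel {z : ℂ} (hz : ‖z‖ < 1) :
    Continuous fun ζ : Circle => (1 + z * conj (ζ : ℂ)) / (1 - z * conj (ζ : ℂ)) := by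
  have := continuous_conj_circle
  exact Continuous.div (by fun_prop) (by fun_prop) (one_sub_mul_conj_ne_zero hz)

theorem integrable_of_continuous_circle {F : Type*} [NormedAddCommGroup F]
    {lam : Measure Circle} [IsFiniteMeasure lam] {f : Circle → F} (hf : Continuous f) :
    Integrable f lam :=
  hf.integrable_of_hasCompactSupport (HasCompactSupport.of_compactSpace f)

section Herglotz

variable (lam : Measure Circle) [IsFiniteMeasure lam]

theorem differentiableOn_herglotzC :
    DifferentiableOn ℂ (herglotzC lam) (Metric.ball 0 1) := by
  intro z hz
  rw [mem_ball_zero_iff] at hz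
  refine DifferentiableAt.differentiableWithinAt ?_
  obtain ⟨r, hzr, hr1⟩ := exists_between hz
  have hcc := continuous_conj_circle
  have hs : Metric.ball (0 : ℂ) r ∈ nhds z :=
    Metric.isOpen_ball.mem_nhds (by rwa [mem_ball_zero_iff])
  refine (hasDerivAt_integral_of_dominated_loc_of_deriv_le (μ := lam) (x₀ := z)
    (F := fun z (ζ : Circle) => (1 + z * conj (ζ : ℂ)) / (1 - z * conj (ζ : ℂ)))
    (F' := fun z (ζ : Circle) => 2 * conj (ζ : ℂ) / (1 - z * conj (ζ : ℂ)) ^ 2)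
    (bound := fun _ => 2 / (1 - r) ^ 2) hs ?_ ?_ ?_ ?_ (integrable_const _) ?_).2.differentiableAt
  · filter_upwards [hs] with x hx
    rw [mem_ball_zero_iff] at hx
    exact (continuous_herglotz_kernel (hx.trans hr1)).aestronglyMeasurable
  · exact integrable_of_continuous_circle (continuous_herglotz_kernel hz)
  · refine Continuous.aestronglyMeasurable (Continuous.div (by fun_prop) (by fun_prop) ?_)
    exact fun ζ => pow_ne_zero 2 (one_sub_mul_conj_ne_zero hz ζ)
  · refine Filter.Eventually.of_forall fun ζ x hx => ?_
    rw [mem_ball_zero_iff] at hx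
    rw [norm_div, norm_mul, RCLike.norm_conj, Circle.norm_coe, norm_pow, mul_one]
    have h1 := one_sub_norm_le x ζ
    have h2 : 0 < 1 - r := by linarith
    have h3 : 1 - r ≤ ‖1 - x * conj (ζ : ℂ)‖ := by linarith
    rw [show ‖(2 : ℂ)‖ = 2 by simp]
    gcongr
  · refine Filter.Eventually.of_forall fun ζ x hx => ?_
    rw [mem_ball_zero_iff] at hx
    have hne := one_sub_mul_conj_ne_zero (hx.trans hr1) ζ
    have hd : HasDerivAt (fun x : ℂ => x * conj (ζ : ℂ)) (conj (ζ : ℂ)) x := by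
      simpa using (hasDerivAt_id x).mul_const (conj (ζ : ℂ))
    refine ((hd.const_add 1).div (hd.const_sub 1) hne).congr_deriv ?_
    ring

theorem re_herglotz_kernel (z : ℂ) (ζ : Circle) :
    ((1 + z * conj (ζ : ℂ)) / (1 - z * conj (ζ : ℂ))).re =
      (1 - ‖z‖ ^ 2) / ‖1 - z * conj (ζ : ℂ)‖ ^ 2 := by
  have h := congrFun (poissonKernel_eq_re_herglotzRieszKernel (c := 0) (w := z * conj (ζ : ℂ))) 1
  rw [poissonKernel, Function.comp_apply, herglotzRieszKernel] at h
  simp only [sub_zero, norm_mul_conj_circle, norm_one, one_pow] at h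
  exact h.symm

theorem re_herglotzC {z : ℂ} (hz : ‖z‖ < 1) :
    (herglotzC lam z).re = ∫ ζ : Circle, (1 - ‖z‖ ^ 2) / ‖1 - z * conj (ζ : ℂ)‖ ^ 2 ∂lam := by
  rw [herglotzC, ← Complex.reCLM_apply, ← ContinuousLinearMap.integral_comp_comm _
    (integrable_of_continuous_circle (continuous_herglotz_kernel hz))]
  simp only [Complex.reCLM_apply, re_herglotz_kernel]

theorem re_herglotzC_nonneg {z : ℂ} (hz : ‖z‖ < 1) : 0 ≤ (herglotzC lam z).re := by
  rw [re_herglotzC lam hz]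
  refine integral_nonneg fun ζ => div_nonneg ?_ (by positivity)
  have : ‖z‖ ^ 2 ≤ 1 := pow_le_one₀ (norm_nonneg z) hz.le
  linarith

theorem herglotzC_add_one_ne_zero {z : ℂ} (hz : ‖z‖ < 1) : herglotzC lam z + 1 ≠ 0 := by
  intro h
  have h1 := re_herglotzC_nonneg lam hz
  have h2 := congrArg Complex.re h
  rw [Complex.add_re, Complex.one_re, Complex.zero_re] at h2
  linarith

/-! ### Clark functions and the analytic minorant of a non-extreme measure. -/

theorem norm_add_one_sq_sub (w : ℂ) : ‖w + 1‖ ^ 2 - ‖w - 1‖ ^ 2 = 4 * w.re := by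
  rw [← Complex.normSq_eq_norm_sq, ← Complex.normSq_eq_norm_sq, Complex.normSq_apply,
    Complex.normSq_apply]
  simp
  ring

theorem clark_mem_contractiveAnalytic : clark lam ∈ contractiveAnalytic := by
  refine ⟨⟨fun z => (herglotzC lam z - 1) / (herglotzC lam z + 1), ?_, fun z => rfl⟩, fun z => ?_⟩
  · refine ((differentiableOn_herglotzC lam).sub_const 1).div
      ((differentiableOn_herglotzC lam).add_const 1) fun z hz => ?_
    exact herglotzC_add_one_ne_zero lam (by simpa using hz)
  · have hz := z.norm_lt_one
    have h1 := re_herglotzC_nonneg lam hz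
    have h2 := norm_add_one_sq_sub (herglotzC lam z)
    rw [clark, herglotz_eq, norm_div,
      div_le_one (norm_pos_iff.2 (herglotzC_add_one_ne_zero lam hz))]
    exact le_of_sq_le_sq (by linarith) (norm_nonneg _)

/-- A quantitative form of strict convexity of the disk: the last term measures how far the midpoint
stays inside. -/
theorem weighted_norm_sq_identity {a b : ℝ} (hab : a + b = 1) (x y : ℂ) :
    a * ‖x‖ ^ 2 + b * ‖y‖ ^ 2 = ‖a • x + b • y‖ ^ 2 + a * b * ‖x - y‖ ^ 2 := by
  obtain rfl : b = 1 - a := by linarith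
  simp only [← Complex.normSq_eq_norm_sq, Complex.normSq_apply, Complex.add_re, Complex.add_im,
    Complex.sub_re, Complex.sub_im, Complex.real_smul, Complex.re_ofReal_mul,
    Complex.im_ofReal_mul]
  ring

/-- If `λ` is not extreme, the real part of its Herglotz–Riesz transform dominates the square
modulus of a non-zero analytic function. -/
theorem exists_analytic_sq_le_re_herglotzC (h : ¬ IsExtremeMeasure lam) :
    ∃ G : ℂ → ℂ, DifferentiableOn ℂ G (Metric.ball 0 1) ∧ (∃ z, ‖z‖ < 1 ∧ G z ≠ 0) ∧
      ∀ z, ‖z‖ < 1 → ‖G z‖ ^ 2 ≤ (herglotzC lam z).re := by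
  rw [IsExtremeMeasure, mem_extremePoints_iff_left, not_and] at h
  have h' := h (clark_mem_contractiveAnalytic lam)
  push Not at h'
  obtain ⟨x₁, ⟨⟨F₁, hF₁, e₁⟩, hx₁⟩, x₂, ⟨⟨F₂, hF₂, e₂⟩, hx₂⟩, ⟨a, b, ha, hb, hab, hx⟩, hne⟩ := h'
  have hpos : 0 < √(a * b) := Real.sqrt_pos.2 (mul_pos ha hb)
  -- Strict convexity gives `|b_λ|² + ab|F₁ - F₂|² ≤ 1`. Multiplying by `|H + 1|²` and using `|H +
  -- 1|² - |H - 1|² = 4 Re H` dictates this choice.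
  refine ⟨fun z => (√(a * b) : ℂ) * (F₁ z - F₂ z) * (herglotzC lam z + 1) / 2,
    (((hF₁.sub hF₂).const_mul _).mul ((differentiableOn_herglotzC lam).add_const 1)).div_const 2,
    ?_, fun z hz => ?_⟩
  · have hne' : x₁ ≠ x₂ := by
      rintro rfl
      rw [← add_smul, hab, one_smul] at hx
      exact hne hx
    obtain ⟨z, hz⟩ := Function.ne_iff.1 hne'
    refine ⟨z, z.norm_lt_one, ?_⟩
    refine div_ne_zero (mul_ne_zero (mul_ne_zero (by exact_mod_cast hpos.ne') ?_)
      (herglotzC_add_one_ne_zero lam z.norm_lt_one)) two_ne_zero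
    rw [← e₁, ← e₂]
    exact sub_ne_zero.2 hz
  · let ζ : 𝔻 := ⟨z, by simpa using hz⟩
    have h1 := weighted_norm_sq_identity hab (x₁ ζ) (x₂ ζ)
    have h2 : a • x₁ ζ + b • x₂ ζ = clark lam ζ := congrFun hx ζ
    have h3 : ‖x₁ ζ‖ ^ 2 ≤ 1 := pow_le_one₀ (norm_nonneg _) (hx₁ ζ)
    have h4 : ‖x₂ ζ‖ ^ 2 ≤ 1 := pow_le_one₀ (norm_nonneg _) (hx₂ ζ)
    have h5 : ‖clark lam ζ‖ ^ 2 + a * b * ‖x₁ ζ - x₂ ζ‖ ^ 2 ≤ 1 := by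
      rw [← h2, ← h1]
      nlinarith
    rw [e₁, e₂, clark, herglotz_eq] at h5
    change ‖(herglotzC lam z - 1) / (herglotzC lam z + 1)‖ ^ 2 + a * b * ‖F₁ z - F₂ z‖ ^ 2 ≤ 1
      at h5
    have h6 : 0 < ‖herglotzC lam z + 1‖ := norm_pos_iff.2 (herglotzC_add_one_ne_zero lam hz)
    have h7 := norm_add_one_sq_sub (herglotzC lam z)
    have h8 : ‖herglotzC lam z - 1‖ ^ 2 +
        a * b * ‖F₁ z - F₂ z‖ ^ 2 * ‖herglotzC lam z + 1‖ ^ 2 ≤ ‖herglotzC lam z + 1‖ ^ 2 := by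
      have := mul_le_mul_of_nonneg_right h5 (sq_nonneg ‖herglotzC lam z + 1‖)
      rwa [add_mul, norm_div, div_pow, div_mul_cancel₀ _ (by positivity), one_mul] at this
    rw [norm_div, norm_mul, norm_mul, div_pow, mul_pow, mul_pow, Complex.norm_real,
      Real.norm_of_nonneg hpos.le, Real.sq_sqrt (mul_pos ha hb).le]
    rw [show ‖(2 : ℂ)‖ = 2 by simp]
    linarith

/-- Removal of the zero at the origin of an analytic function in the disk. -/
theorem exists_eq_pow_mul {G : ℂ → ℂ} (hG : DifferentiableOn ℂ G (Metric.ball 0 1))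
    (hne : ∃ z, ‖z‖ < 1 ∧ G z ≠ 0) : ∃ (k : ℕ) (F : ℂ → ℂ),
      DifferentiableOn ℂ F (Metric.ball 0 1) ∧ F 0 ≠ 0 ∧
        ∀ z, ‖z‖ < 1 → G z = z ^ k * F z := by
  have h0 : (0 : ℂ) ∈ Metric.ball (0 : ℂ) 1 := by simp
  have han : AnalyticOnNhd ℂ G (Metric.ball 0 1) := hG.analyticOnNhd Metric.isOpen_ball
  have hev : ¬ ∀ᶠ z in nhds 0, G z = 0 := by
    intro hev
    obtain ⟨z, hz, hz0⟩ := hne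
    exact hz0 (han.eqOn_zero_of_preconnected_of_eventuallyEq_zero
      (convex_ball 0 1).isPreconnected h0 hev (by simpa using hz))
  obtain ⟨k, g, hg, hg0, hgG⟩ := (han 0 h0).exists_eventuallyEq_pow_smul_nonzero_iff.2 hev
  simp only [sub_zero, smul_eq_mul] at hgG
  classical
  refine ⟨k, fun z => if z = 0 then g 0 else G z / z ^ k, ?_, by simpa using hg0, fun z _ => ?_⟩
  · intro z hz
    refine DifferentiableAt.differentiableWithinAt ?_
    rcases eq_or_ne z 0 with rfl | hz0
    · refine hg.differentiableAt.congr_of_eventuallyEq ?_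
      filter_upwards [hgG] with w hw
      split_ifs with hw0
      · rw [hw0]
      · rw [hw, mul_div_cancel_left₀ _ (pow_ne_zero k hw0)]
    · have h1 : DifferentiableAt ℂ (fun w => G w / w ^ k) z :=
        (hG.differentiableAt (Metric.isOpen_ball.mem_nhds hz)).div (by fun_prop)
          (pow_ne_zero k hz0)
      refine h1.congr_of_eventuallyEq ?_
      filter_upwards [isOpen_ne.mem_nhds hz0] with w hw
      rw [if_neg hw]
  · rcases eq_or_ne z 0 with rfl | hz0
    · simpa using hgG.self_of_nhds
    · simp only [if_neg hz0]
      rw [mul_div_cancel₀ _ (pow_ne_zero k hz0)]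

/-! ### Bounded evaluation at the origin, and constants in `ℋ⁺(λ)`. -/

/-- On the circle, the square modulus of a polynomial is the real part of a polynomial. -/
theorem exists_re_eq_norm_sq (q : ℂ[X]) :
    ∃ Q : ℂ[X], ∀ z : ℂ, ‖z‖ = 1 → (Q.eval z).re = ‖q.eval z‖ ^ 2 := by
  induction q using Polynomial.recOnHorner with
  | M0 => exact ⟨0, by simp⟩
  | MC p a _ _ ih =>
    obtain ⟨Q, hQ⟩ := ih
    -- From `|p + a|² = |p|² + 2 Re(ā p) + |a|²`; the other Horner step, multiplication by `X`,
    -- keeps the modulus on the circle.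
    refine ⟨Q + C (2 * conj a) * p + C (‖a‖ ^ 2 : ℂ), fun z hz => ?_⟩
    simp only [eval_add, eval_mul, eval_C, Complex.add_re, hQ z hz]
    rw [← Complex.normSq_eq_norm_sq (_ + a), Complex.normSq_add, Complex.normSq_eq_norm_sq,
      Complex.normSq_eq_norm_sq]
    rw [← Complex.ofReal_pow, Complex.ofReal_re, mul_assoc, mul_comm (conj a)]
    simp
    ring
  | MX p _ ih =>
    obtain ⟨Q, hQ⟩ := ih
    exact ⟨Q, fun z hz => by rw [hQ z hz, eval_mul, eval_X, norm_mul, hz, mul_one]⟩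

/-- Symmetry of the Poisson kernel: `rz` seen from `ζ` is `rζ` seen from `z`. After Fubini, this
turns the average over `z` into the Poisson formula for `Re Q` at `rζ`. -/
theorem norm_one_sub_smul_conj (r : ℝ) {z : ℂ} (hz : ‖z‖ = 1) (ζ : Circle) :
    ‖1 - (r * z) * conj (ζ : ℂ)‖ = ‖z - r * ζ‖ := by
  have h1 : 1 - (r * z) * conj (ζ : ℂ) = z * conj (z - r * ζ) := by
    have h2 : z * conj z = 1 := by rw [Complex.mul_conj, Complex.normSq_eq_norm_sq, hz]; simp
    rw [map_sub, mul_sub, h2, map_mul, Complex.conj_ofReal]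
    ring
  rw [h1, norm_mul, hz, one_mul, RCLike.norm_conj]

/-- Integration of a Poisson integral against the real part of a polynomial. -/
theorem circleAverage_re_eval_mul_re_herglotzC (Q : ℂ[X]) {r : ℝ} (hr0 : 0 ≤ r) (hr1 : r < 1) :
    Real.circleAverage (fun z => (Q.eval z).re * (herglotzC lam (r * z)).re) 0 1 =
      ∫ ζ : Circle, (Q.eval (r * (ζ : ℂ))).re ∂lam := by
  let P : ℂ → Circle → ℝ := fun z ζ => (1 - r ^ 2) / ‖1 - (r * z) * conj (ζ : ℂ)‖ ^ 2
  have hnorm : ∀ z : ℂ, ‖z‖ = 1 → ‖(r : ℂ) * z‖ = r := fun z hz => by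
    rw [norm_mul, hz, mul_one, Complex.norm_real, Real.norm_of_nonneg hr0]
  have hmap : ∀ θ : ℝ, ‖circleMap 0 1 θ‖ = 1 := fun θ => by simp
  have hinner : ∀ ζ : Circle,
      Real.circleAverage (fun z => (Q.eval z).re * P z ζ) 0 1 = (Q.eval (r * (ζ : ℂ))).re := by
    intro ζ
    have hw : (r * (ζ : ℂ)) ∈ Metric.ball (0 : ℂ) 1 := by
      rw [mem_ball_zero_iff, hnorm _ (Circle.norm_coe ζ)]
      exact hr1
    have hd : DiffContOnCl ℂ (fun z => Q.eval z) (Metric.ball 0 1) :=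
      Q.differentiable.diffContOnCl
    have h1 := hd.circleAverage_poissonKernel_smul' hw
    have hint : CircleIntegrable (fun z : ℂ => ((‖z - 0‖ ^ 2 - ‖r * (ζ : ℂ) - 0‖ ^ 2) /
        ‖z - 0 - (r * (ζ : ℂ) - 0)‖ ^ 2) • Q.eval z) 0 1 := by
      refine ContinuousOn.circleIntegrable zero_le_one ?_
      refine ContinuousOn.smul (ContinuousOn.div
        (f := fun z : ℂ => ‖z - 0‖ ^ 2 - ‖r * (ζ : ℂ) - 0‖ ^ 2)
        (g := fun z : ℂ => ‖z - 0 - (r * (ζ : ℂ) - 0)‖ ^ 2) (by fun_prop) (by fun_prop) ?_)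
        Q.continuous.continuousOn
      intro z hz
      rw [mem_sphere_zero_iff_norm] at hz
      refine pow_ne_zero 2 (norm_ne_zero_iff.2 ?_)
      rw [sub_zero, sub_zero, sub_ne_zero]
      rintro rfl
      rw [hnorm _ (Circle.norm_coe ζ)] at hz
      linarith
    have h2 := Complex.reCLM.circleAverage_comp_comm hint
    rw [h1] at h2
    rw [← Complex.reCLM_apply, ← h2]
    refine Real.circleAverage_congr_sphere fun z hz => ?_
    rw [abs_one, mem_sphere_zero_iff_norm] at hz
    simp only [Function.comp_apply, Complex.reCLM_apply, sub_zero, hz, P,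
      hnorm _ (Circle.norm_coe ζ), norm_one_sub_smul_conj r hz, Complex.smul_re, one_pow,
      smul_eq_mul]
    ring
  have hcc := continuous_conj_circle
  have hcont : Continuous fun p : ℝ × Circle =>
      (Q.eval (circleMap 0 1 p.1)).re * P (circleMap 0 1 p.1) p.2 := by
    have hc1 : Continuous fun p : ℝ × Circle => circleMap 0 1 p.1 :=
      (continuous_circleMap 0 1).comp continuous_fst
    have hc2 : Continuous fun p : ℝ × Circle => conj (p.2 : ℂ) := hcc.comp continuous_snd
    refine (Complex.continuous_re.comp (Q.continuous.comp hc1)).mul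
      (Continuous.div (by fun_prop) (by fun_prop) fun p => ?_)
    refine pow_ne_zero 2 (norm_ne_zero_iff.2 (one_sub_mul_conj_ne_zero ?_ _))
    rw [hnorm _ (hmap _)]
    exact hr1
  have hswap := intervalIntegral_integral_swap (μ := lam) (a := 0) (b := 2 * Real.pi)
    (f := fun θ ζ => (Q.eval (circleMap 0 1 θ)).re * P (circleMap 0 1 θ) ζ) (by
      have h1 : IntegrableOn (Function.uncurry fun θ ζ =>
          (Q.eval (circleMap 0 1 θ)).re * P (circleMap 0 1 θ) ζ)
          (Set.uIcc 0 (2 * Real.pi) ×ˢ Set.univ) (volume.prod lam) :=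
        ContinuousOn.integrableOn_compact (isCompact_uIcc.prod isCompact_univ) hcont.continuousOn
      have h2 := h1.mono_set (Set.prod_mono_left (t := Set.univ)
        (Set.uIoc_subset_uIcc (a := 0) (b := 2 * Real.pi)))
      rwa [IntegrableOn, ← Measure.prod_restrict, Measure.restrict_univ] at h2)
  simp only [← hinner, Real.circleAverage_def]
  rw [integral_smul, ← hswap]
  congr 1
  refine intervalIntegral.integral_congr fun θ _ => ?_
  simp only [P]
  rw [integral_const_mul, re_herglotzC lam (by rw [hnorm _ (hmap θ)]; exact hr1), hnorm _ (hmap θ)]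

theorem norm_circleAverage_le (f : ℂ → ℂ) :
    ‖Real.circleAverage f 0 1‖ ≤ Real.circleAverage (fun z => ‖f z‖) 0 1 := by
  rw [Real.circleAverage_def, Real.circleAverage_def, norm_smul,
    Real.norm_of_nonneg (by positivity), smul_eq_mul]
  gcongr
  exact intervalIntegral.norm_integral_le_integral_norm (by positivity)

/-- Evaluation at the origin is bounded on the polynomials in `L²(λ)`, if the real part of the
Herglotz–Riesz transform dominates `|z ^ k F(z)|²` with `F(0) ≠ 0`. -/
theorem norm_eval_zero_le {k : ℕ} {F : ℂ → ℂ} (hF : DifferentiableOn ℂ F (Metric.ball 0 1))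
    (hle : ∀ z, ‖z‖ < 1 → ‖z ^ k * F z‖ ^ 2 ≤ (herglotzC lam z).re) (q : ℂ[X]) :
    ‖q.eval 0 * F 0‖ ^ 2 ≤ ∫ ζ : Circle, ‖q.eval (ζ : ℂ)‖ ^ 2 ∂lam := by
  obtain ⟨Q, hQ⟩ := exists_re_eq_norm_sq q
  have hr : ∀ r ∈ Set.Ioo (0 : ℝ) 1, (r ^ k) ^ 2 * ‖q.eval 0 * F 0‖ ^ 2 ≤
      ∫ ζ : Circle, (Q.eval (r * (ζ : ℂ))).re ∂lam := by
    rintro r ⟨hr0, hr1⟩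
    have hnorm : ∀ z : ℂ, ‖(r : ℂ) * z‖ = r * ‖z‖ := fun z => by
      rw [norm_mul, Complex.norm_real, Real.norm_of_nonneg hr0.le]
    have hmem : ∀ z : ℂ, ‖z‖ ≤ 1 → ‖(r : ℂ) * z‖ < 1 := fun z hz => by
      rw [hnorm]
      nlinarith [norm_nonneg z]
    -- The factor is `rᵏ` and not `(rz)ᵏ`: the modulus on the unit circle is the same, but the zero
    -- at the origin is gone, so the mean value property sees `F(0)`.
    let f : ℂ → ℂ := fun z => ((r : ℂ) ^ k * (q.eval z * F (r * z))) ^ 2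
    have hfd : ∀ z : ℂ, ‖z‖ ≤ 1 → DifferentiableAt ℂ f z := by
      intro z hz
      have h1 : DifferentiableAt ℂ F (r * z) :=
        hF.differentiableAt (Metric.isOpen_ball.mem_nhds (by simpa using hmem z hz))
      have h2 : DifferentiableAt ℂ (fun z : ℂ => F (r * z)) z :=
        h1.comp z (by fun_prop)
      exact ((q.differentiable.differentiableAt.mul h2).const_mul _).pow 2
    have hcl : closure (Metric.ball (0 : ℂ) 1) = Metric.closedBall 0 1 :=
      closure_ball _ one_ne_zero
    have hd : DiffContOnCl ℂ f (Metric.ball 0 1) := by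
      refine DifferentiableOn.diffContOnCl fun z hz => ?_
      rw [hcl, mem_closedBall_zero_iff] at hz
      exact (hfd z hz).differentiableWithinAt
    have hfc : ContinuousOn f (Metric.sphere 0 1) := fun z hz =>
      (hfd z (by rw [mem_sphere_zero_iff_norm] at hz; exact hz.le)).continuousAt.continuousWithinAt
    have hmean : Real.circleAverage f 0 1 = f 0 := by
      have := hd.circleAverage_poissonKernel_smul' (w := 0) (by simp)
      rw [← this]
      refine Real.circleAverage_congr_sphere fun z hz => ?_
      rw [abs_one, mem_sphere_zero_iff_norm] at hz
      simp [hz]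
    have hHc : ContinuousOn (fun z : ℂ => (Q.eval z).re * (herglotzC lam (r * z)).re)
        (Metric.sphere 0 1) := by
      refine (Complex.continuous_re.comp Q.continuous).continuousOn.mul
        (Complex.continuous_re.comp_continuousOn ?_)
      refine (differentiableOn_herglotzC lam).continuousOn.comp (by fun_prop) fun z hz => ?_
      rw [mem_sphere_zero_iff_norm] at hz
      simpa using hmem z hz.le
    rw [← circleAverage_re_eval_mul_re_herglotzC lam Q hr0.le hr1]
    calc (r ^ k) ^ 2 * ‖q.eval 0 * F 0‖ ^ 2 = ‖f 0‖ := by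
          simp only [f, mul_zero]
          rw [norm_pow, norm_mul (_ ^ k), norm_pow, Complex.norm_real,
            Real.norm_of_nonneg hr0.le, mul_pow]
      _ ≤ Real.circleAverage (fun z => ‖f z‖) 0 1 := hmean ▸ norm_circleAverage_le f
      _ ≤ _ := by
          refine Real.circleAverage_mono (hfc.norm.circleIntegrable zero_le_one)
            (hHc.circleIntegrable zero_le_one) fun z hz => ?_
          rw [abs_one, mem_sphere_zero_iff_norm] at hz
          have h1 := hle (r * z) (hmem z hz.le)
          have h2 : ‖f z‖ = ‖q.eval z‖ ^ 2 * ‖(r * z) ^ k * F (r * z)‖ ^ 2 := by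
            simp only [f, norm_pow, norm_mul, hz]
            ring
          rw [h2, hQ z hz]
          gcongr
  have hc : Continuous fun r : ℝ => ∫ ζ : Circle, (Q.eval (r * (ζ : ℂ))).re ∂lam := by
    have hcq : Continuous (Function.uncurry fun (r : ℝ) (ζ : Circle) =>
        (Q.eval (r * (ζ : ℂ))).re) := by
      refine Complex.continuous_re.comp (Q.continuous.comp ?_)
      exact (Complex.continuous_ofReal.comp continuous_fst).mul
        (continuous_circle_coe.comp continuous_snd)
    simpa using continuous_parametric_integral_of_continuous (μ := lam) hcq isCompact_univ
  have h1 : (1 : ℝ) ∈ closure (Set.Ioo (0 : ℝ) 1) := by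
    rw [closure_Ioo zero_ne_one]
    simp
  -- Both sides are continuous in `r`, so the inequality extends to `r = 1`, where `Re Q = |q|²`.
  have h2 := (isClosed_le (by fun_prop) hc).closure_subset_iff.2 hr h1
  simp only [Set.mem_ofPred_eq, one_pow, one_mul, Complex.ofReal_one] at h2
  refine h2.trans (le_of_eq ?_)
  refine integral_congr_ae (Filter.Eventually.of_forall fun ζ => ?_)
  exact hQ ζ (Circle.norm_coe ζ)

theorem norm_polyLp_sq (q : ℂ[X]) :
    ‖polyLp lam q‖ ^ 2 = ∫ ζ : Circle, ‖q.eval (ζ : ℂ)‖ ^ 2 ∂lam := by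
  have h1 : ((‖polyLp lam q‖ ^ 2 : ℝ) : ℂ) = ⟪polyLp lam q, polyLp lam q⟫_ℂ := by
    rw [inner_self_eq_norm_sq_to_K]
    norm_cast
  have h2 : polyLp lam q =ᵐ[lam] Polynomial.aeval zeta q :=
    ContinuousMap.coeFn_toLp (𝕜 := ℂ) lam _
  rw [L2.inner_def] at h1
  have h3 : ∫ ζ, ⟪polyLp lam q ζ, polyLp lam q ζ⟫_ℂ ∂lam =
      ∫ ζ : Circle, ((‖q.eval (ζ : ℂ)‖ ^ 2 : ℝ) : ℂ) ∂lam := by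
    refine integral_congr_ae ?_
    filter_upwards [h2] with ζ e
    have e' : (Polynomial.aeval zeta q) ζ = q.eval (ζ : ℂ) := by
      simp [zeta_apply]
    rw [e, e', inner_self_eq_norm_sq_to_K]
    norm_cast
  rw [h3, integral_complex_ofReal] at h1
  exact_mod_cast h1

/-- If evaluation at the origin is bounded on the polynomials in `L²(λ)`, then the constants belong
to `ℋ⁺(λ)`. -/
theorem containsConst_of_eval_zero {c : ℝ} (hc : 0 < c)
    (h : ∀ q : ℂ[X], c * ‖q.eval 0‖ ^ 2 ≤ ‖polyLp lam q‖ ^ 2) : ContainsConst lam := by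
  let R : ℂ[X] →ₗ[ℂ] Lp ℂ 2 lam := polyLp lam ∘ₗ LinearMap.mulLeft ℂ X
  let M : Submodule ℂ (Lp ℂ 2 lam) := (LinearMap.range R).topologicalClosure
  have hMc : IsClosed (M : Set (Lp ℂ 2 lam)) := Submodule.isClosed_topologicalClosure _
  have : CompleteSpace M := hMc.completeSpace_coe
  let one : Lp ℂ 2 lam := polyLp lam 1
  have hone : zetaPowLp lam 0 = one := by
    have := polyLp_X_pow (μ := lam) 0
    rw [pow_zero] at this
    exact this.symm
  have hM : ∀ x ∈ M, c ≤ ‖one - x‖ ^ 2 := by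
    have hcl : IsClosed {x : Lp ℂ 2 lam | c ≤ ‖one - x‖ ^ 2} :=
      isClosed_le continuous_const (by fun_prop)
    intro x hx
    refine hcl.closure_subset_iff.2 ?_ hx
    rintro _ ⟨p, rfl⟩
    -- `1 - Xp` takes the value `1` at the origin, so `c` bounds the squared distance of `1` from
    -- `M`.
    have := h (1 - X * p)
    rw [map_sub] at this
    simpa [R, one] using this
  set k := one - M.starProjection one with hk
  have hkM : k ∈ Mᗮ := M.sub_starProjection_mem_orthogonal one
  have hpos : 0 < ‖k‖ ^ 2 := lt_of_lt_of_le hc (hM _ (M.starProjection_apply_mem one))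
  refine ⟨k, Lp.memLp k, ?_, fun n => ?_⟩
  · have h1 : ⟪M.starProjection one, k⟫_ℂ = 0 :=
      Submodule.inner_right_of_mem_orthogonal (M.starProjection_apply_mem one) hkM
    have h2 : ⟪one, k⟫_ℂ = ⟪k, k⟫_ℂ := by
      conv_rhs => rw [hk, inner_sub_left, ← hk, h1, sub_zero]
    rw [coef_eq_inner, hone, h2]
    intro h3
    rw [inner_self_eq_zero.1 h3] at hpos
    simp at hpos
  · rw [coef_eq_inner, ← polyLp_X_pow]
    refine Submodule.inner_right_of_mem_orthogonal (subset_closure ?_) hkM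
    exact ⟨X ^ n, by simp [R, pow_succ']⟩

theorem containsConst_of_not_isExtremeMeasure {lam : Measure Circle} [IsFiniteMeasure lam]
    (h : ¬ IsExtremeMeasure lam) : ContainsConst lam := by
  obtain ⟨G, hG, hne, hle⟩ := exists_analytic_sq_le_re_herglotzC lam h
  obtain ⟨k, F, hF, hF0, hGF⟩ := exists_eq_pow_mul hG hne
  refine containsConst_of_eval_zero lam (c := ‖F 0‖ ^ 2) (by positivity) fun q => ?_
  rw [norm_polyLp_sq, mul_comm, ← mul_pow, ← norm_mul]
  exact norm_eval_zero_le lam hF (fun z hz => hGF z hz ▸ hle z hz) q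

end Herglotz

end CauchyTransform

end

theorem theorem5p5 (μ lam : Measure Circle) [IsFiniteMeasure μ] [IsFiniteMeasure lam] :
    (¬ IsExtremeMeasure lam → IsReducing (V μ) (intSpace μ lam)) ∧
    (IsReducing (V μ) (intSpace μ lam) →
      ∀ (μac μs : Measure Circle) [IsFiniteMeasure μac] [IsFiniteMeasure μs],
        μ = μac + μs → μac ≪ lam → μs ⟂ₘ lam →
        (∃ (e : HPlus μac →ₗᵢ[ℂ] HPlus μ) (j : HPlus μs →ₗᵢ[ℂ] HPlus μ),
          IsInclusion e ∧ IsInclusion j ∧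
          LinearMap.range e.toLinearMap ⟂ LinearMap.range j.toLinearMap ∧
          LinearMap.range e.toLinearMap ⊔ LinearMap.range j.toLinearMap = ⊤ ∧
          LinearMap.range e.toLinearMap = (intSpace μ lam).topologicalClosure) ∧
        RKSingular μs lam ∧
        RKAbsolutelyContinuous μac lam ∧
        (∀ (γ : Measure Circle) [IsFiniteMeasure γ],
          γ ≤ μ → RKAbsolutelyContinuous γ lam → γ ≤ μac)) := by
  refine ⟨fun h => isReducing_of_containsConst (containsConst_of_not_isExtremeMeasure h), ?_⟩
  intro hred μac μs _ _ hsum hac hsing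
  -- `E` is null for `μs` and carries `λ`, so the two summands are the restrictions of `μ` to `E`
  -- and to `Eᶜ`.
  obtain ⟨E, hE, hsE, hlE⟩ := hsing
  have h1 : μac = μ.restrict E := by
    rw [hsum, Measure.restrict_add, Measure.restrict_eq_zero.2 hsE, add_zero,
      Measure.restrict_eq_self_of_ae_mem]
    exact measure_mono_null (fun x hx => hx) (hac hlE)
  have h2 : μs = μ.restrict Eᶜ := by
    rw [hsum, Measure.restrict_add, Measure.restrict_eq_zero.2 (hac hlE), zero_add,
      Measure.restrict_eq_self_of_ae_mem]
    exact measure_mono_null (fun x hx => not_not.1 hx) hsE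
  clear hsum
  subst h1 h2
  exact decomposition_of_isReducing hred hE hlE hac
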